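/- Let $k$ be a field and let $F\in k[x,y,z,w]$ be a nonzero homogeneous polynomial of degree $d$, so that $X=V(F)\subset\mathbb{P}^3_k$ is a surface of degree $d$. A curve is a closed subscheme $C\subset\mathbb{P}^3_k$ of dimension one (not necessarily reduced or irreducible), with saturated homogeneous ideal $I_C\subset k[x,y,z,w]$. It is ACM if its homogeneous coordinate ring $k[x,y,z,w]/I_C$ is Cohen--Macaulay, and it is a complete intersection if $I_C$ is generated by two homogeneous polynomials. Suppose that $X$ contains an ACM curve $C$ (that is, $F\in I_C$) which is not a complete intersection. Then there are an integer $t\geq 2$ and sequences of integers $\hat a=(a_1\leq\dots\leq a_t)$ and $\hat b=(b_1\leq\dots\leq b_t)$ with $a_i<b_i$ for all $i$ and $\sum_{i=1}^t(b_i-a_i)=d$ (a weak admissible pair of degree $d$ and length $t$), such that $X$ is weak determinantal of type $(\hat a,\hat b)$: one has $F=\det(m_{ij})$ for a $t\times t$ matrix $(m_{ij})$ over $k[x,y,z,w]$ in which $m_{ij}$ is homogeneous of degree $b_j-a_i$ whenever $a_i<b_j$, and $m_{ij}=0$ whenever $a_i\geq b_j$. -/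

import Mathlib

noncomputable section

/-- A local ring `R` is Cohen--Macaulay if its maximal ideal contains a regular sequence whose
length is the Krull dimension of `R`. (Only used for Noetherian rings.) -/
def IsCohenMacaulayLocal (R : Type*) [CommRing R] [IsLocalRing R] : Prop :=
  ∃ rs : List R, (∀ r ∈ rs, r ∈ IsLocalRing.maximalIdeal R) ∧
    RingTheory.Sequence.IsRegular R rs ∧ (rs.length : WithBot ℕ∞) = ringKrullDim R

/-- A Noetherian ring is Cohen--Macaulay if all its localizations at maximal ideals are. -/
def IsCohenMacaulay (R : Type*) [CommRing R] : Prop :=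
  IsNoetherianRing R ∧
    ∀ (m : Ideal R) [m.IsMaximal], IsCohenMacaulayLocal (Localization.AtPrime m)

/-- The homogeneous coordinate ring `k[x, y, z, w]` of projective three-space. -/
abbrev CoordRing (k : Type*) [Field k] : Type _ := MvPolynomial (Fin 4) k

/-- The standard grading of `k[x, y, z, w]`, so that `ℙ³ = Proj` of this graded ring. -/
abbrev stdGrading (k : Type*) [Field k] : ℕ → Submodule k (CoordRing k) :=
  MvPolynomial.homogeneousSubmodule (Fin 4) k

instance stdGrading.gradedAlgebra (k : Type*) [Field k] : GradedAlgebra (stdGrading k) :=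
  MvPolynomial.gradedAlgebra

/-- A curve in `ℙ³`: a closed subscheme of dimension one, not necessarily reduced, irreducible or
smooth. Closed subschemes of `ℙ³` correspond bijectively to saturated homogeneous ideals of
`k[x, y, z, w]`, the subscheme being given by the homogeneous ideal of all forms that vanish on
it; `ideal` is this ideal. The underlying space of the curve is the zero locus of `ideal` in
`Proj k[x, y, z, w]`. -/
structure SpaceCurve (k : Type*) [Field k] where
  /-- the homogeneous ideal of the curve -/
  ideal : HomogeneousIdeal (stdGrading k)
  /-- saturation with respect to the irrelevant ideal `(x, y, z, w)` -/
  saturated : ∀ f : CoordRing k,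
    (∃ n : ℕ, ∀ g ∈ (HomogeneousIdeal.irrelevant (stdGrading k)).toIdeal ^ n,
      g * f ∈ ideal.toIdeal) → f ∈ ideal.toIdeal
  /-- the underlying topological space has dimension one -/
  dim_eq_one : topologicalKrullDim
    (ProjectiveSpectrum.zeroLocus (stdGrading k) (ideal.toIdeal : Set (CoordRing k))) = 1

namespace SpaceCurve

variable {k : Type*} [Field k]

/-- The curve is arithmetically Cohen--Macaulay: its homogeneous coordinate ring is
Cohen--Macaulay. -/
def IsACM (C : SpaceCurve k) : Prop :=
  IsCohenMacaulay (CoordRing k ⧸ C.ideal.toIdeal)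

/-- The curve is a complete intersection of two surfaces: its homogeneous ideal is generated by
two forms. -/
def IsCompleteIntersection (C : SpaceCurve k) : Prop :=
  ∃ (G H : CoordRing k) (m n : ℕ), G.IsHomogeneous m ∧ H.IsHomogeneous n ∧
    C.ideal.toIdeal = Ideal.span {G, H}

/-- The curve is contained, as a subscheme, in the surface `V(F)`. -/
def LiesOn (C : SpaceCurve k) (F : CoordRing k) : Prop :=
  F ∈ C.ideal.toIdeal

end SpaceCurve

/-- `(a, b)` is a weak admissible pair of length `t`. -/
structure IsWeakAdmissiblePair {t : ℕ} (a b : Fin t → ℤ) : Prop where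
  two_le_length : 2 ≤ t
  monotone_left : Monotone a
  monotone_right : Monotone b
  lt : ∀ i, a i < b i

/-- The degree `∑ (bᵢ - aᵢ)` of a pair of sequences. -/
def pairDegree {t : ℕ} (a b : Fin t → ℤ) : ℤ := ∑ i, (b i - a i)

/-- The surface `V(F)` is weak determinantal of type `(a, b)`: the pair is weak admissible and
`F` is the determinant of a matrix whose `(i, j)` entry is a form of degree `b j - a i` if
`a i < b j`, and zero if `b j ≤ a i`. -/
def IsWeakDeterminantal {k : Type*} [Field k] (F : CoordRing k) {t : ℕ} (a b : Fin t → ℤ) : Prop :=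
  IsWeakAdmissiblePair a b ∧
    ∃ M : Matrix (Fin t) (Fin t) (CoordRing k),
      (∀ i j, a i < b j → (M i j).IsHomogeneous (b j - a i).toNat) ∧
      (∀ i j, b j ≤ a i → M i j = 0) ∧
      F = M.det

end

/-!
Let `R = k[x, y, z, w]`, let `I` be the homogeneous ideal of the curve and `𝔪` the irrelevant ideal.

The idea is the Hilbert–Burch theorem: an ACM curve has codimension two and projective dimension
two, so `I` is generated by the maximal minors of a homogeneous matrix `s` with `n` rows and `n + 1`
columns, whose rows are a basis of the syzygies of a minimal system of generators `g` of `I`. If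
`F = ∑ fᵢ gᵢ`, then `F` is the determinant of `s` augmented by the row `f`. Degree-zero entries of
`s` vanish by minimality of `g`. If `f` has a nonzero entry of degree zero, `F` is itself a minimal
generator; exchanging it for one of the `gᵢ` makes `F` a maximal minor of `s`. As the curve is not a
complete intersection, `n ≥ 2`, so the determinant has size at least two in either case
(`exists_generators_adapted`, `exists_isWeakDeterminantal_of_det_eq`).

The projective dimension is bounded without general homological algebra. A chain of two irreducible
closed subsets of the curve shows that `R/I` has dimension at least two at `𝔪`, so by the
Cohen–Macaulay hypothesis there is a regular sequence of length two there. This gives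
`Ext¹(k, R/I) = 0` (`extOneVanishes_of_isCohenMacaulay`), which is the vanishing of the third Koszul
homology of `R/I`. By dimension shifting the first Koszul homology of the syzygy module of `g`
vanishes (`koszul_exact_one_syzygies`), and a graded module with this property is free
(`linearIndependent_of_extOneVanishes`).

The Hilbert–Burch theorem `exists_unit_sum_mul_eq_detCons` also needs that the elements of `I` have
no common factor. This is the upper bound on the dimension of the curve: a prime of height one
containing `I` would produce a chain of three irreducible closed subsets
(`not_le_of_height_le_one`).
-/

open MvPolynomial

/-! ### The Koszul complex of the variables -/

theorem MvPolynomial.mem_span_X_image_of_X_mul_mem {σ R : Type*} [CommRing R] {s : Set σ} {i : σ}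
    (hi : i ∉ s) {a : MvPolynomial σ R}
    (h : X i * a ∈ Ideal.span (X '' s : Set (MvPolynomial σ R))) :
    a ∈ Ideal.span (X '' s : Set (MvPolynomial σ R)) := by
  classical
  rw [mem_ideal_span_X_image] at h ⊢
  intro m hm
  have h1 : Finsupp.single i 1 + m ∈ (X i * a).support := by
    rw [mem_support_iff, coeff_X_mul]
    exact mem_support_iff.mp hm
  obtain ⟨j, hj, hj'⟩ := h _ h1
  refine ⟨j, hj, ?_⟩
  have hij : i ≠ j := fun hij => hi (hij ▸ hj)
  simpa [Finsupp.single_apply, hij] using hj'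

section Koszul

variable {k : Type*} [Field k]

/-- Exactness of the Koszul complex of `x₀, x₁, x₂` in degree one. -/
theorem koszul_three_exact_one {v₀ v₁ v₂ : CoordRing k}
    (h : X 0 * v₀ + X 1 * v₁ + X 2 * v₂ = 0) :
    ∃ n₀ n₁ n₂ : CoordRing k, v₀ = X 1 * n₂ - X 2 * n₁ ∧ v₁ = X 2 * n₀ - X 0 * n₂ ∧
      v₂ = X 0 * n₁ - X 1 * n₀ := by
  have h2 : v₂ ∈ Ideal.span (X '' ({0, 1} : Set (Fin 4)) : Set (CoordRing k)) := by
    apply mem_span_X_image_of_X_mul_mem (i := 2) (by simp)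
    rw [Set.image_pair, Ideal.mem_span_pair]
    exact ⟨-v₀, -v₁, by linear_combination -h⟩
  rw [Set.image_pair, Ideal.mem_span_pair] at h2
  obtain ⟨p, q, hpq⟩ := h2
  have h1 : v₁ + X 2 * q ∈ Ideal.span (X '' ({0} : Set (Fin 4)) : Set (CoordRing k)) := by
    apply mem_span_X_image_of_X_mul_mem (i := 1) (by simp)
    rw [Set.image_singleton, Ideal.mem_span_singleton']
    exact ⟨-v₀ - X 2 * p, by rw [← hpq] at h; linear_combination -h⟩
  rw [Set.image_singleton, Ideal.mem_span_singleton'] at h1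
  obtain ⟨r, hr⟩ := h1
  refine ⟨-q, p, -r, ?_, by linear_combination -hr, by linear_combination -hpq⟩
  have : (X 0 : CoordRing k) * (v₀ + X 1 * r + X 2 * p) = 0 := by
    linear_combination h + X 1 * hr + X 2 * hpq
  have := (mul_eq_zero.mp this).resolve_left (X_ne_zero _)
  linear_combination this

/-- Exactness of the Koszul complex of `x₀, x₁, x₂, x₃` in degree one. -/
theorem koszul_exact_one {v₀ v₁ v₂ v₃ : CoordRing k}
    (h : X 0 * v₀ + X 1 * v₁ + X 2 * v₂ + X 3 * v₃ = 0) :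
    ∃ t₀₁ t₀₂ t₀₃ t₁₂ t₁₃ t₂₃ : CoordRing k,
      v₀ = X 1 * t₀₁ + X 2 * t₀₂ + X 3 * t₀₃ ∧
      v₁ = -X 0 * t₀₁ + X 2 * t₁₂ + X 3 * t₁₃ ∧
      v₂ = -X 0 * t₀₂ - X 1 * t₁₂ + X 3 * t₂₃ ∧
      v₃ = -X 0 * t₀₃ - X 1 * t₁₃ - X 2 * t₂₃ := by
  have h3 : v₃ ∈ Ideal.span (X '' ({0, 1, 2} : Set (Fin 4)) : Set (CoordRing k)) := by
    apply mem_span_X_image_of_X_mul_mem (i := 3) (by simp)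
    rw [Set.image_insert_eq, Set.image_pair, Submodule.mem_span_triple]
    exact ⟨-v₀, -v₁, -v₂, by simp only [smul_eq_mul]; linear_combination -h⟩
  rw [Set.image_insert_eq, Set.image_pair, Submodule.mem_span_triple] at h3
  obtain ⟨p, q, r, hpqr⟩ := h3
  simp only [smul_eq_mul] at hpqr
  obtain ⟨n₀, n₁, n₂, e₀, e₁, e₂⟩ := koszul_three_exact_one
    (v₀ := v₀ + X 3 * p) (v₁ := v₁ + X 3 * q) (v₂ := v₂ + X 3 * r)
    (by linear_combination h + X 3 * hpqr)
  exact ⟨n₂, -n₁, -p, n₀, -q, -r, by linear_combination e₀, by linear_combination e₁,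
    by linear_combination e₂, by linear_combination -hpqr⟩

/-- Exactness of the Koszul complex of `x₀, x₁, x₂, x₃` in degree two; three-chains are written
in the dual basis. The remaining cycle condition `x₀t₀₂ + x₁t₁₂ = x₃t₂₃` follows from these
three. -/
theorem koszul_exact_two {t₀₁ t₀₂ t₀₃ t₁₂ t₁₃ t₂₃ : CoordRing k}
    (h₀ : X 1 * t₀₁ + X 2 * t₀₂ + X 3 * t₀₃ = 0)
    (h₁ : -X 0 * t₀₁ + X 2 * t₁₂ + X 3 * t₁₃ = 0)
    (h₃ : -X 0 * t₀₃ - X 1 * t₁₃ - X 2 * t₂₃ = 0) :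
    ∃ n : Fin 4 → CoordRing k,
      t₀₁ = X 2 * n 3 - X 3 * n 2 ∧ t₀₂ = X 3 * n 1 - X 1 * n 3 ∧
      t₀₃ = X 1 * n 2 - X 2 * n 1 ∧ t₁₂ = X 0 * n 3 - X 3 * n 0 ∧
      t₁₃ = X 2 * n 0 - X 0 * n 2 ∧ t₂₃ = X 0 * n 1 - X 1 * n 0 := by
  obtain ⟨n₀, n₁, n₂, e₀, e₁, e₂⟩ := koszul_three_exact_one
    (v₀ := t₀₃) (v₁ := t₁₃) (v₂ := t₂₃) (by linear_combination -h₃)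
  have hm : t₀₁ + X 3 * n₂ ∈ Ideal.span (X '' ({2} : Set (Fin 4)) : Set (CoordRing k)) := by
    apply mem_span_X_image_of_X_mul_mem (i := 0) (by simp)
    rw [Set.image_singleton, Ideal.mem_span_singleton']
    exact ⟨t₁₂ + X 3 * n₀, by rw [e₁] at h₁; linear_combination h₁⟩
  rw [Set.image_singleton, Ideal.mem_span_singleton'] at hm
  obtain ⟨n₃, hn₃⟩ := hm
  have h02 : (X 2 : CoordRing k) * (t₀₂ - X 3 * n₁ + X 1 * n₃) = 0 := by
    rw [e₀] at h₀; linear_combination h₀ + X 1 * hn₃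
  have h12 : (X 2 : CoordRing k) * (t₁₂ + X 3 * n₀ - X 0 * n₃) = 0 := by
    rw [e₁] at h₁; linear_combination h₁ - X 0 * hn₃
  have h02 := (mul_eq_zero.mp h02).resolve_left (X_ne_zero _)
  have h12 := (mul_eq_zero.mp h12).resolve_left (X_ne_zero _)
  refine ⟨![n₀, n₁, n₂, n₃], ?_, ?_, ?_, ?_, ?_, ?_⟩ <;>
    simp only [Matrix.cons_val]
  · linear_combination -hn₃
  · linear_combination h02
  · exact e₀
  · linear_combination h12
  · exact e₁
  · exact e₂

/-- The ideal `I` satisfies `Ext¹(k, R/I) = 0`, where `R = k[x, y, z, w]`: a homomorphism from the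
irrelevant ideal to `R/I`, given by the images `n i` of the variables, is multiplication by an
element of `R/I`. -/
def ExtOneVanishes (I : Ideal (CoordRing k)) : Prop :=
  ∀ n : Fin 4 → CoordRing k, (∀ i j, X i * n j - X j * n i ∈ I) →
    ∃ u : CoordRing k, ∀ i, n i - X i * u ∈ I

/-- If `Ext¹(k, R/I) = 0`, then the first Koszul homology of the syzygy module of a system of
generators `g` of `I` vanishes. This is dimension shifting: that homology is the second Koszul
homology of `I`, and the third of `R/I`, which is `Ext¹(k, R/I)` by self-duality. -/
theorem koszul_exact_one_syzygies {ι : Type*} [Fintype ι] {I : Ideal (CoordRing k)}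
    (hI : ExtOneVanishes I) (g : ι → CoordRing k) (hg : Ideal.span (Set.range g) = I)
    (σ : Fin 4 → ι → CoordRing k) (hσ : ∀ j, ∑ i, σ j i * g i = 0)
    (h : ∀ i, X 0 * σ 0 i + X 1 * σ 1 i + X 2 * σ 2 i + X 3 * σ 3 i = 0) :
    ∃ t : Fin 4 → Fin 4 → ι → CoordRing k, (∀ a b, ∑ i, t a b i * g i = 0) ∧
      (∀ a b i, t a b i = -t b a i) ∧ (∀ a i, t a a i = 0) ∧
      ∀ a i, σ a i = X 0 * t a 0 i + X 1 * t a 1 i + X 2 * t a 2 i + X 3 * t a 3 i := by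
  have hmem : ∀ f ∈ I, ∃ c : ι → CoordRing k, ∑ i, c i * g i = f := by
    intro f hf
    rw [← hg] at hf
    exact (Ideal.mem_span_range_iff_exists_fun).mp hf
  have hgI : ∀ c : ι → CoordRing k, ∑ i, c i * g i ∈ I := fun c =>
    Ideal.sum_mem _ fun i _ => Ideal.mul_mem_left _ _ (hg ▸ Ideal.subset_span ⟨i, rfl⟩)
  choose t₀₁ t₀₂ t₀₃ t₁₂ t₁₃ t₂₃ e₀ e₁ e₂ e₃ using fun i => koszul_exact_one (h i)
  have hs0 : ∑ i, σ 0 i * g i = X 1 * ∑ i, t₀₁ i * g i + X 2 * ∑ i, t₀₂ i * g i +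
      X 3 * ∑ i, t₀₃ i * g i := by
    simp only [Finset.mul_sum, ← Finset.sum_add_distrib]
    exact Finset.sum_congr rfl fun i _ => by rw [e₀]; ring
  have hs1 : ∑ i, σ 1 i * g i = -X 0 * ∑ i, t₀₁ i * g i + X 2 * ∑ i, t₁₂ i * g i +
      X 3 * ∑ i, t₁₃ i * g i := by
    simp only [Finset.mul_sum, ← Finset.sum_add_distrib]
    exact Finset.sum_congr rfl fun i _ => by rw [e₁]; ring
  have hs3 : ∑ i, σ 3 i * g i = -X 0 * ∑ i, t₀₃ i * g i - X 1 * ∑ i, t₁₃ i * g i -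
      X 2 * ∑ i, t₂₃ i * g i := by
    simp only [Finset.mul_sum, ← Finset.sum_sub_distrib]
    exact Finset.sum_congr rfl fun i _ => by rw [e₃]; ring
  obtain ⟨n, d₀₁, d₀₂, d₀₃, d₁₂, d₁₃, d₂₃⟩ := koszul_exact_two
    (hs0 ▸ hσ 0) (hs1 ▸ hσ 1) (hs3 ▸ hσ 3)
  -- modulo `I`, the three-chain `n` is a cycle
  obtain ⟨u, hu⟩ := hI n (by
    have key : ∀ (c : ι → CoordRing k) (f : CoordRing k), ∑ i, c i * g i = f →
        f ∈ I ∧ -f ∈ I := fun c f hf => ⟨hf ▸ hgI c, neg_mem (hf ▸ hgI c)⟩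
    have k1 := key _ _ d₀₁
    have k2 := key _ _ d₀₂
    have k3 := key _ _ d₀₃
    have k4 := key _ _ d₁₂
    have k5 := key _ _ d₁₃
    have k6 := key _ _ d₂₃
    simp only [neg_sub] at k1 k2 k3 k4 k5 k6
    intro i j
    fin_cases i <;> fin_cases j <;>
      simp only [sub_self, Submodule.zero_mem, Fin.zero_eta, Fin.mk_one, Fin.reduceFinMk, k1, k2,
        k3, k4, k5, k6])
  choose w hw using fun i => hmem _ (hu i)
  have hlin : ∀ (a : ι → CoordRing k) (p q : CoordRing k) (b c : Fin 4),
      ∑ i, (a i - (p * w b i - q * w c i)) * g i =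
        ∑ i, a i * g i - (p * (n b - X b * u) - q * (n c - X c * u)) := by
    intro a p q b c
    rw [← hw b, ← hw c]
    simp only [Finset.mul_sum, ← Finset.sum_sub_distrib]
    exact Finset.sum_congr rfl fun i _ => by ring
  let T₀₁ := fun i => t₀₁ i - (X 2 * w 3 i - X 3 * w 2 i)
  let T₀₂ := fun i => t₀₂ i - (X 3 * w 1 i - X 1 * w 3 i)
  let T₀₃ := fun i => t₀₃ i - (X 1 * w 2 i - X 2 * w 1 i)
  let T₁₂ := fun i => t₁₂ i - (X 0 * w 3 i - X 3 * w 0 i)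
  let T₁₃ := fun i => t₁₃ i - (X 2 * w 0 i - X 0 * w 2 i)
  let T₂₃ := fun i => t₂₃ i - (X 0 * w 1 i - X 1 * w 0 i)
  have z₀₁ : ∑ i, T₀₁ i * g i = 0 := by rw [hlin, d₀₁]; ring
  have z₀₂ : ∑ i, T₀₂ i * g i = 0 := by rw [hlin, d₀₂]; ring
  have z₀₃ : ∑ i, T₀₃ i * g i = 0 := by rw [hlin, d₀₃]; ring
  have z₁₂ : ∑ i, T₁₂ i * g i = 0 := by rw [hlin, d₁₂]; ring
  have z₁₃ : ∑ i, T₁₃ i * g i = 0 := by rw [hlin, d₁₃]; ring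
  have z₂₃ : ∑ i, T₂₃ i * g i = 0 := by rw [hlin, d₂₃]; ring
  refine ⟨![![0, T₀₁, T₀₂, T₀₃], ![-T₀₁, 0, T₁₂, T₁₃], ![-T₀₂, -T₁₂, 0, T₂₃],
    ![-T₀₃, -T₁₃, -T₂₃, 0]], ?_, ?_, ?_, ?_⟩
  · intro a b
    fin_cases a <;> fin_cases b <;> simp [z₀₁, z₀₂, z₀₃, z₁₂, z₁₃, z₂₃]
  · intro a b i
    fin_cases a <;> fin_cases b <;> simp
  · intro a i
    fin_cases a <;> simp
  · intro a i
    fin_cases a <;> simp [T₀₁, T₀₂, T₀₃, T₁₂, T₁₃, T₂₃, e₀, e₁, e₂, e₃] <;> ring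

end Koszul

/-! ### Graded free modules -/

section Graded

variable {σ R ι : Type*} [CommRing R]

theorem MvPolynomial.homogeneousComponent_mul_of_isHomogeneous_right {f g : MvPolynomial σ R}
    {m : ℕ} (hg : g.IsHomogeneous m) (n : ℕ) :
    homogeneousComponent n (f * g) =
      if m ≤ n then homogeneousComponent (n - m) f * g else 0 := by
  classical
  let _ : GradedAlgebra (homogeneousSubmodule σ R) := MvPolynomial.gradedAlgebra
  have h := DirectSum.coe_decompose_mul_of_right_mem (𝒜 := homogeneousSubmodule σ R) (a := f) n
    ((mem_homogeneousSubmodule m g).mpr hg)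
  have hd : ∀ (f : MvPolynomial σ R) i, (DirectSum.decompose (homogeneousSubmodule σ R) f i :
    MvPolynomial σ R) = homogeneousComponent i f := decomposition.decompose'_apply
  rwa [hd, hd] at h

/-- `v` is a homogeneous element of degree `b` of the graded free module `⨁ᵢ S(-eᵢ)` over the
polynomial ring `S`. -/
def IsShiftedHomogeneous (e : ι → ℕ) (b : ℕ) (v : ι → MvPolynomial σ R) : Prop :=
  ∀ i, (e i ≤ b → (v i).IsHomogeneous (b - e i)) ∧ (b < e i → v i = 0)

/-- The homogeneous component of degree `b` of an element of the graded free module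
`⨁ᵢ S(-eᵢ)` over the polynomial ring `S`. -/
noncomputable def shiftedComponent (e : ι → ℕ) (b : ℕ) (v : ι → MvPolynomial σ R) :
    ι → MvPolynomial σ R :=
  fun i => if e i ≤ b then homogeneousComponent (b - e i) (v i) else 0

theorem isShiftedHomogeneous_shiftedComponent (e : ι → ℕ) (b : ℕ) (v : ι → MvPolynomial σ R) :
    IsShiftedHomogeneous e b (shiftedComponent e b v) := by
  intro i
  refine ⟨fun h => ?_, fun h => ?_⟩
  · simpa [shiftedComponent, h] using homogeneousComponent_isHomogeneous _ _
  · simp [shiftedComponent, not_le.mpr h]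

theorem exists_sum_shiftedComponent_eq [Fintype ι] (e : ι → ℕ) (v : ι → MvPolynomial σ R) :
    ∃ B, ∑ b ∈ Finset.range B, shiftedComponent e b v = v := by
  classical
  refine ⟨∑ i, (e i + (v i).totalDegree) + 1, ?_⟩
  ext i m
  rw [Finset.sum_apply, coeff_sum]
  have hB : e i + (v i).totalDegree ≤ ∑ i, (e i + (v i).totalDegree) :=
    Finset.single_le_sum (f := fun i => e i + (v i).totalDegree) (fun _ _ => Nat.zero_le _)
      (Finset.mem_univ i)
  have hterm : ∀ b, coeff m (shiftedComponent e b v i) =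
      if b = e i + m.degree then coeff m (v i) else 0 := by
    intro b
    unfold shiftedComponent
    by_cases h : e i ≤ b
    · rw [if_pos h, coeff_homogeneousComponent]
      congr 1
      exact propext (by omega)
    · rw [if_neg h, if_neg (by omega), coeff_zero]
  simp only [hterm, Finset.sum_ite_eq', Finset.mem_range]
  split_ifs with h
  · rfl
  · symm
    apply coeff_eq_zero_of_totalDegree_lt
    have : m.degree = ∑ i ∈ m.support, m i := rfl
    omega

/-- Taking components commutes with linear combinations of homogeneous elements `s j`, that is,
`r ↦ ∑ rⱼ sⱼ` is a graded homomorphism. -/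
theorem shiftedComponent_sum_smul {κ : Type*} [Fintype κ] {e : ι → ℕ} {β : κ → ℕ}
    {s : κ → ι → MvPolynomial σ R} (hs : ∀ j, IsShiftedHomogeneous e (β j) (s j))
    (r : κ → MvPolynomial σ R) (b : ℕ) :
    shiftedComponent e b (∑ j, r j • s j) = ∑ j, shiftedComponent β b r j • s j := by
  ext1 i
  simp only [shiftedComponent, Finset.sum_apply, Pi.smul_apply, smul_eq_mul]
  split_ifs with hb
  · rw [map_sum]
    refine Finset.sum_congr rfl fun j _ => ?_
    by_cases h : e i ≤ β j
    · rw [homogeneousComponent_mul_of_isHomogeneous_right ((hs j i).1 h)]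
      by_cases h' : β j ≤ b
      · rw [if_pos (by omega), if_pos h', show b - e i - (β j - e i) = b - β j by omega]
      · rw [if_neg (by omega), if_neg h', zero_mul]
    · rw [(hs j i).2 (by omega)]
      simp
  · symm
    refine Finset.sum_eq_zero fun j _ => ?_
    split_ifs with h
    · rw [(hs j i).2 (by omega), mul_zero]
    · rw [zero_mul]

theorem homogeneousComponent_sum_mul {κ : Type*} [Fintype κ] {β : κ → ℕ}
    {g : κ → MvPolynomial σ R} (hg : ∀ j, (g j).IsHomogeneous (β j))
    (r : κ → MvPolynomial σ R) (b : ℕ) :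
    homogeneousComponent b (∑ j, r j * g j) = ∑ j, shiftedComponent β b r j * g j := by
  have := congr_fun (shiftedComponent_sum_smul (ι := Unit) (e := 0) (β := β)
    (s := fun j _ => g j) (fun j _ => ⟨fun _ => hg j, fun h => absurd h (by simp)⟩) r b) ()
  simpa only [shiftedComponent, Finset.sum_apply, Pi.smul_apply, smul_eq_mul, Pi.zero_apply,
    zero_le, if_true, tsub_zero] using this

theorem span_isShiftedHomogeneous_eq [Fintype ι] {e : ι → ℕ}
    {N : Submodule (MvPolynomial σ R) (ι → MvPolynomial σ R)}
    (hN : ∀ v ∈ N, ∀ b, shiftedComponent e b v ∈ N) :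
    Submodule.span (MvPolynomial σ R) {v | v ∈ N ∧ ∃ b, IsShiftedHomogeneous e b v} = N := by
  refine le_antisymm (Submodule.span_le.mpr fun v hv => hv.1) fun v hv => ?_
  obtain ⟨B, hB⟩ := exists_sum_shiftedComponent_eq e v
  rw [← hB]
  exact Submodule.sum_mem _ fun b _ => Submodule.subset_span
    ⟨hN v hv b, b, isShiftedHomogeneous_shiftedComponent e b v⟩

end Graded

/-! ### Minimal systems of homogeneous generators -/

section Minimal

theorem exists_minimal_generators {A M : Type*} [Ring A] [AddCommGroup M] [Module A M]
    [IsNoetherian A M] (H : Set M) :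
    ∃ (p : ℕ) (s : Fin p → M), (∀ j, s j ∈ H) ∧
      Submodule.span A (Set.range s) = Submodule.span A H ∧
      ∀ (q : ℕ) (s' : Fin q → M), (∀ j, s' j ∈ H) →
        Submodule.span A (Set.range s') = Submodule.span A H → p ≤ q := by
  classical
  have hex : ∃ (p : ℕ) (s : Fin p → M), (∀ j, s j ∈ H) ∧
      Submodule.span A (Set.range s) = Submodule.span A H := by
    obtain ⟨t, htH, ht⟩ := (Submodule.fg_span_iff_fg_span_finset_subset H).mp
      (IsNoetherian.noetherian (Submodule.span A H))
    refine ⟨t.card, fun j => (t.equivFin.symm j : M), fun j => htH (t.equivFin.symm j).2, ?_⟩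
    rw [ht]
    congr 1
    ext x
    simp only [Set.mem_range, Finset.mem_coe]
    exact ⟨fun ⟨j, hj⟩ => hj ▸ (t.equivFin.symm j).2,
      fun hx => ⟨t.equivFin ⟨x, hx⟩, by simp⟩⟩
  obtain ⟨s, hs, hspan⟩ := Nat.find_spec hex
  exact ⟨Nat.find hex, s, hs, hspan, fun q s' h1 h2 => Nat.find_min' hex ⟨s', h1, h2⟩⟩

theorem notMem_span_of_minimal {A M : Type*} [Ring A] [AddCommGroup M] [Module A M] {H : Set M}
    {p : ℕ} {s : Fin p → M} (hs : ∀ j, s j ∈ H)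
    (hspan : Submodule.span A (Set.range s) = Submodule.span A H)
    (hmin : ∀ (q : ℕ) (s' : Fin q → M), (∀ j, s' j ∈ H) →
        Submodule.span A (Set.range s') = Submodule.span A H → p ≤ q) (j : Fin p) :
    s j ∉ Submodule.span A (s '' {j}ᶜ) := by
  intro hj
  obtain _ | q := p
  · exact j.elim0
  have hr : Set.range (s ∘ j.succAbove) = s '' {j}ᶜ := by
    rw [Set.range_comp, Fin.range_succAbove]
  have := hmin q (s ∘ j.succAbove) (fun i => hs _) (by
    rw [← hspan, hr]
    refine le_antisymm (Submodule.span_mono (Set.image_subset_range _ _)) ?_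
    rw [Submodule.span_le]
    rintro _ ⟨i, rfl⟩
    by_cases hi : i = j
    · exact hi ▸ hj
    · exact Submodule.subset_span ⟨i, hi, rfl⟩)
  omega

/-- A graded relation between irredundant homogeneous generators has coefficients without
constant term. -/
theorem constantCoeff_eq_zero_of_notMem_span {σ k M κ : Type*} [Field k] [Fintype κ]
    [AddCommGroup M] [Module (MvPolynomial σ k) M] {s : κ → M} {β : κ → ℕ}
    {r : κ → MvPolynomial σ k} {j : κ}
    (hj : s j ∉ Submodule.span (MvPolynomial σ k) (s '' {j}ᶜ))
    (hr : ∑ i, shiftedComponent β (β j) r i • s i = 0) : constantCoeff (r j) = 0 := by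
  classical
  by_contra hc
  apply hj
  have h0 : shiftedComponent β (β j) r j = C (constantCoeff (r j)) := by
    simp [shiftedComponent, constantCoeff_eq]
  rw [← Finset.add_sum_erase _ _ (Finset.mem_univ j), h0] at hr
  have hmem : (C (constantCoeff (r j)) : MvPolynomial σ k) • s j ∈
      Submodule.span (MvPolynomial σ k) (s '' {j}ᶜ) := by
    rw [eq_neg_of_add_eq_zero_left hr]
    refine neg_mem (Submodule.sum_mem _ fun i hi => Submodule.smul_mem _ _
      (Submodule.subset_span ⟨i, ?_, rfl⟩))
    simpa using (Finset.mem_erase.mp hi).1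
  have := Submodule.smul_mem _ (C (constantCoeff (r j))⁻¹ : MvPolynomial σ k) hmem
  rwa [smul_smul, ← C_mul, inv_mul_cancel₀ hc, C_1, one_smul] at this

end Minimal

theorem MvPolynomial.mem_span_range_X_iff {σ R : Type*} [CommRing R] {f : MvPolynomial σ R} :
    f ∈ Ideal.span (Set.range (X : σ → MvPolynomial σ R)) ↔ constantCoeff f = 0 := by
  rw [← Set.image_univ, mem_ideal_span_X_image, constantCoeff_eq]
  constructor
  · intro h
    by_contra h0
    obtain ⟨i, -, hi⟩ := h 0 (mem_support_iff.mpr h0)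
    exact hi rfl
  · intro h m hm
    have : m ≠ 0 := fun h0 => mem_support_iff.mp hm (h0 ▸ h)
    obtain ⟨i, hi⟩ := Finsupp.ne_iff.mp this
    exact ⟨i, trivial, hi⟩

section Syzygies

variable {k : Type*} [Field k]

/-- If the relations between generators `s` of a module of syzygies have coefficients without
constant term, and the first Koszul homology of that module vanishes, then there are no relations.
Indeed the module `K` of relations satisfies `K = 𝔪 K`. -/
theorem linearIndependent_of_extOneVanishes {ι κ : Type*} [Fintype ι] [Fintype κ]
    {I : Ideal (CoordRing k)} (hI : ExtOneVanishes I) {g : ι → CoordRing k}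
    (hg : Ideal.span (Set.range g) = I) {s : κ → ι → CoordRing k}
    (hs : ∀ j, ∑ i, s j i * g i = 0)
    (hspan : ∀ v : ι → CoordRing k, ∑ i, v i * g i = 0 →
      v ∈ Submodule.span (CoordRing k) (Set.range s))
    (hmin : ∀ r : κ → CoordRing k, ∑ j, r j • s j = 0 → ∀ j, constantCoeff (r j) = 0) :
    LinearIndependent (CoordRing k) s := by
  rw [Fintype.linearIndependent_iff]
  set 𝔪 : Ideal (CoordRing k) := Ideal.span (Set.range X) with h𝔪
  have hpow : ∀ (t : ℕ) (r : κ → CoordRing k), ∑ j, r j • s j = 0 → ∀ j, r j ∈ 𝔪 ^ t := by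
    intro t
    induction t with
    | zero => intro r _ j; simp
    | succ t ih =>
      intro r hr
      have hv : ∀ j, ∃ v : Fin 4 → CoordRing k, ∑ a, v a * X a = r j := fun j =>
        (Ideal.mem_span_range_iff_exists_fun).mp (mem_span_range_X_iff.mpr (hmin r hr j))
      choose v hv using hv
      have hcomb : ∀ c : κ → CoordRing k, ∑ i, (∑ j, c j • s j) i * g i = 0 := by
        intro c
        simp only [Finset.sum_apply, Pi.smul_apply, smul_eq_mul, Finset.sum_mul]
        rw [Finset.sum_comm]
        refine Finset.sum_eq_zero fun j _ => ?_
        simp only [mul_assoc, ← Finset.mul_sum, hs, mul_zero]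
      obtain ⟨T, hT, hTalt, hT0, hTσ⟩ := koszul_exact_one_syzygies hI g hg
        (fun a => ∑ j, v j a • s j) (fun a => hcomb _) (by
          intro i
          have := congr_fun hr i
          simp only [Finset.sum_apply, Pi.smul_apply, smul_eq_mul, Finset.mul_sum,
            Pi.zero_apply, ← Finset.sum_add_distrib] at this ⊢
          rw [← this]
          refine Finset.sum_congr rfl fun j _ => ?_
          rw [← hv j, Fin.sum_univ_four]
          ring)
      have hτ : ∀ a b, ∃ τ : κ → CoordRing k, ∑ j, τ j • s j = T a b := fun a b =>
        (Submodule.mem_span_range_iff_exists_fun _).mp (hspan _ (hT a b))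
      choose τ₀ hτ₀ using hτ
      -- an alternating choice of coefficients
      let τ : Fin 4 → Fin 4 → κ → CoordRing k := fun a b =>
        if a < b then τ₀ a b else if b < a then -τ₀ b a else 0
      have hτ : ∀ a b, ∑ j, τ a b j • s j = T a b := by
        intro a b
        rcases lt_trichotomy a b with h | h | h
        · simp only [τ, if_pos h, hτ₀]
        · subst h
          simp only [τ, lt_irrefl, if_false, Pi.zero_apply, zero_smul, Finset.sum_const_zero]
          exact (funext (hT0 a)).symm
        · simp only [τ, if_neg h.not_gt, if_pos h, Pi.neg_apply, neg_smul,
            Finset.sum_neg_distrib, hτ₀]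
          exact (funext fun i => hTalt a b i).symm
      have hv' : ∀ a, ∑ j, (v j a - ∑ b, X b * τ a b j) • s j = 0 := by
        intro a
        have h1 : ∑ j, (v j a - ∑ b, X b * τ a b j) • s j =
            ∑ j, v j a • s j - ∑ b, (X b : CoordRing k) • ∑ j, τ a b j • s j := by
          simp only [sub_smul, Finset.sum_sub_distrib, Finset.sum_smul, Finset.smul_sum, mul_smul]
          rw [Finset.sum_comm]
        rw [h1, sub_eq_zero]
        ext1 i
        rw [hTσ a i, Fin.sum_univ_four]
        simp only [hτ, Pi.add_apply, Pi.smul_apply, smul_eq_mul]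
      intro j
      have hrj : r j = ∑ a, (v j a - ∑ b, X b * τ a b j) * X a := by
        rw [← hv j]
        simp only [Fin.sum_univ_four, τ]
        simp
        ring
      rw [hrj, pow_succ]
      exact Ideal.sum_mem _ fun a _ => Ideal.mul_mem_mul (ih _ (hv' a) j)
        (Ideal.subset_span ⟨a, rfl⟩)
  intro r hr j
  have hne : 𝔪 ≠ ⊤ := by
    rw [Ideal.ne_top_iff_one, h𝔪, mem_span_range_X_iff]
    simp
  have : r j ∈ ⨅ t : ℕ, 𝔪 ^ t := (Submodule.mem_iInf _).mpr fun t => hpow t r hr j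
  rwa [Ideal.iInf_pow_eq_bot_of_isDomain 𝔪 hne] at this

/-- If `Ext¹(k, R/I) = 0`, then the syzygies of homogeneous generators of `I` form a free module
with a homogeneous basis; in other words `R/I` has projective dimension at most two. -/
theorem exists_homogeneous_basis_syzygies {ι : Type*} [Fintype ι] {I : Ideal (CoordRing k)}
    (hI : ExtOneVanishes I) {g : ι → CoordRing k} (hg : Ideal.span (Set.range g) = I)
    {e : ι → ℕ} (hge : ∀ i, (g i).IsHomogeneous (e i)) :
    ∃ (p : ℕ) (s : Fin p → ι → CoordRing k) (β : Fin p → ℕ),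
      (∀ j, IsShiftedHomogeneous e (β j) (s j)) ∧ (∀ j, ∑ i, s j i * g i = 0) ∧
      LinearIndependent (CoordRing k) s ∧
      ∀ v : ι → CoordRing k, ∑ i, v i * g i = 0 →
        v ∈ Submodule.span (CoordRing k) (Set.range s) := by
  let S : Submodule (CoordRing k) (ι → CoordRing k) :=
    LinearMap.ker (Fintype.linearCombination (CoordRing k) g)
  have hS : ∀ v, v ∈ S ↔ ∑ i, v i * g i = 0 := fun v => by
    simp [S, LinearMap.mem_ker, Fintype.linearCombination_apply]
  have hcomp : ∀ v ∈ S, ∀ b, shiftedComponent e b v ∈ S := by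
    intro v hv b
    rw [hS] at hv ⊢
    rw [← homogeneousComponent_sum_mul hge, hv, map_zero]
  obtain ⟨p, s, hsH, hspan, hmin⟩ := exists_minimal_generators (A := CoordRing k)
    {v | v ∈ S ∧ ∃ b, IsShiftedHomogeneous e b v}
  have hirr := notMem_span_of_minimal hsH hspan hmin
  rw [span_isShiftedHomogeneous_eq hcomp] at hspan
  choose β hβ using fun j => (hsH j).2
  have hs : ∀ j, ∑ i, s j i * g i = 0 := fun j => (hS _).mp (hsH j).1
  have hspan' : ∀ v : ι → CoordRing k, ∑ i, v i * g i = 0 →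
      v ∈ Submodule.span (CoordRing k) (Set.range s) := fun v hv => by
    rw [hspan]; exact (hS v).mpr hv
  refine ⟨p, s, β, hβ, hs, ?_, hspan'⟩
  refine linearIndependent_of_extOneVanishes hI hg hs hspan' fun r hr j =>
    constantCoeff_eq_zero_of_notMem_span (β := β) (hirr j) ?_
  rw [← shiftedComponent_sum_smul hβ, hr]
  ext1 i
  simp [shiftedComponent]

end Syzygies

/-! ### The Hilbert–Burch theorem -/

section HilbertBurch

variable {A : Type*} [CommRing A]

/-- The determinant with rows `f, s₀, …, s_{p-1}` as a linear function of `f`. -/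
noncomputable def detCons {p : ℕ} (s : Fin p → Fin (p + 1) → A) : (Fin (p + 1) → A) →ₗ[A] A :=
  (Matrix.detRowAlternating (R := A) (n := Fin (p + 1))).toMultilinearMap.toLinearMap
    (Fin.cons 0 s) 0

theorem detCons_apply {p : ℕ} (s : Fin p → Fin (p + 1) → A) (f : Fin (p + 1) → A) :
    detCons s f = (Matrix.of (Fin.cons f s : Fin (p + 1) → Fin (p + 1) → A)).det := by
  simp only [detCons, MultilinearMap.toLinearMap_apply, Fin.update_cons_zero]
  rfl

theorem detCons_eq_zero_of_mem_span {p : ℕ} {s : Fin p → Fin (p + 1) → A}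
    {f : Fin (p + 1) → A} (hf : f ∈ Submodule.span A (Set.range s)) : detCons s f = 0 := by
  have : Submodule.span A (Set.range s) ≤ LinearMap.ker (detCons s) := by
    rw [Submodule.span_le]
    rintro _ ⟨j, rfl⟩
    rw [SetLike.mem_coe, LinearMap.mem_ker, detCons_apply]
    exact Matrix.det_zero_of_row_eq (i := 0) (j := j.succ) (Fin.succ_ne_zero j).symm rfl
  exact this hf

theorem detCons_ne_zero_of_linearIndependent [IsDomain A] {p : ℕ} {s : Fin p → Fin (p + 1) → A}
    {f : Fin (p + 1) → A}
    (h : LinearIndependent A (Fin.cons f s : Fin (p + 1) → Fin (p + 1) → A)) :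
    detCons s f ≠ 0 := by
  classical
  rw [detCons_apply]
  intro h0
  obtain ⟨v, hv, hv0⟩ := Matrix.exists_vecMul_eq_zero_iff.mpr h0
  rw [Fintype.linearIndependent_iff] at h
  apply hv
  ext1 j
  refine h v ?_ j
  rw [Matrix.vecMul_eq_sum] at hv0
  exact hv0

/-- `p` linearly independent vectors of `A^{p+1}` have a nonzero maximal minor. -/
theorem exists_detCons_ne_zero [IsDomain A] {p : ℕ} {s : Fin p → Fin (p + 1) → A}
    (h : LinearIndependent A s) : ∃ f, detCons s f ≠ 0 := by
  obtain ⟨f, hf⟩ := exists_linearIndependent_cons_of_lt_finrank h (by simp)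
  exact ⟨f, detCons_ne_zero_of_linearIndependent hf⟩

theorem map_detCons {B : Type*} [CommRing B] (φ : A →+* B) {p : ℕ} (s : Fin p → Fin (p + 1) → A)
    (f : Fin (p + 1) → A) :
    φ (detCons s f) = detCons (fun j i => φ (s j i)) (fun i => φ (f i)) := by
  rw [detCons_apply, detCons_apply, RingHom.map_det]
  congr 1
  ext i j
  refine Fin.cases ?_ (fun i => ?_) i <;> simp

theorem card_add_one_eq_of_basis_syzygies [IsDomain A] {p N : ℕ} {g : Fin N → A}
    {s : Fin p → Fin N → A} (hg : ∃ i, g i ≠ 0) (hs : ∀ j, ∑ i, s j i * g i = 0)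
    (hli : LinearIndependent A s)
    (hspan : ∀ v : Fin N → A, ∑ i, v i * g i = 0 → v ∈ Submodule.span A (Set.range s)) :
    p + 1 = N := by
  let φ : (Fin N → A) →ₗ[A] A := Fintype.linearCombination A g
  have hφ : ∀ v, φ v = ∑ i, v i * g i := fun v => by
    simp [φ, Fintype.linearCombination_apply]
  have hker : LinearMap.ker φ = Submodule.span A (Set.range s) := by
    refine le_antisymm (fun v hv => hspan v (by rwa [← hφ])) (Submodule.span_le.mpr ?_)
    rintro _ ⟨j, rfl⟩
    rw [SetLike.mem_coe, LinearMap.mem_ker, hφ, hs]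
  have h1 : Module.finrank A (LinearMap.ker φ) = p := by
    rw [hker, finrank_span_eq_card hli, Fintype.card_fin]
  have h2 : Module.finrank A (LinearMap.range φ) = 1 := by
    refine le_antisymm ((Submodule.finrank_le _).trans (Module.finrank_self A).le) ?_
    rw [Nat.one_le_iff_ne_zero, Ne, Submodule.finrank_eq_zero]
    intro h0
    obtain ⟨i, hi⟩ := hg
    apply hi
    have : φ (Pi.single i 1) ∈ LinearMap.range φ := ⟨_, rfl⟩
    rw [h0, Submodule.mem_bot, hφ] at this
    simpa [Pi.single_apply] using this
  have h3 := Submodule.finrank_quotient_add_finrank (LinearMap.ker φ)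
  rw [LinearEquiv.finrank_eq φ.quotKerEquivRange, h1, h2, Module.finrank_fin_fun] at h3
  omega

/-- The **Hilbert–Burch theorem**: if the syzygies of `g` have a basis `s`, and the elements of `g`
have no common factor, then `g` is, up to a unit, the vector of signed maximal minors of `s`.

Both vectors are annihilated by `s`, hence proportional, `u gᵢ = v Dᵢ` with `u` and `v` coprime.
Here `v` divides all `gᵢ`. If a prime `c` divided `u`, the maximal minors would vanish modulo `c`,
and `s` would be linearly dependent modulo `c`, which is absurd since a syzygy divisible by `c` is
`c` times a syzygy. -/
theorem exists_unit_sum_mul_eq_detCons [IsDomain A] [UniqueFactorizationMonoid A] {p : ℕ}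
    {g : Fin (p + 1) → A} {s : Fin p → Fin (p + 1) → A}
    (hcop : ∀ v, (∀ i, v ∣ g i) → IsUnit v) (hg : ∃ i, g i ≠ 0)
    (hs : ∀ j, ∑ i, s j i * g i = 0) (hli : LinearIndependent A s)
    (hspan : ∀ v : Fin (p + 1) → A, ∑ i, v i * g i = 0 → v ∈ Submodule.span A (Set.range s)) :
    ∃ u : Aˣ, ∀ f : Fin (p + 1) → A, ∑ i, f i * g i = u * detCons s f := by
  obtain ⟨i₀, hi₀⟩ := hg
  -- proportionality of `g` and the vector of minors
  have hprop : ∀ f, g i₀ * detCons s f = (∑ i, f i * g i) * detCons s (Pi.single i₀ 1) := by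
    intro f
    have hmem : g i₀ • f - (∑ i, f i * g i) • Pi.single i₀ 1 ∈
        Submodule.span A (Set.range s) := by
      apply hspan
      simp only [Pi.sub_apply, Pi.smul_apply, smul_eq_mul, sub_mul, Finset.sum_sub_distrib,
        mul_assoc, ← Finset.mul_sum]
      simp [Pi.single_apply, mul_comm]
    have := detCons_eq_zero_of_mem_span hmem
    rwa [map_sub, map_smul, map_smul, smul_eq_mul, smul_eq_mul, sub_eq_zero] at this
  obtain ⟨v, u, c, hrel, hv, hu⟩ := UniqueFactorizationMonoid.exists_reduced_factors (g i₀) hi₀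
    (detCons s (Pi.single i₀ 1))
  have hc : c ≠ 0 := by
    rintro rfl
    exact hi₀ (by rw [← hv, zero_mul])
  have hprop' : ∀ f, v * detCons s f = u * ∑ i, f i * g i := by
    intro f
    have := hprop f
    rw [← hv, ← hu] at this
    exact mul_left_cancel₀ hc (by linear_combination this)
  have hvu : IsUnit v := by
    refine hcop v fun i => hrel.dvd_of_dvd_mul_left ?_
    have := hprop' (Pi.single i 1)
    simp only [Pi.single_apply, ite_mul, one_mul, zero_mul, Finset.sum_ite_eq', Finset.mem_univ,
      if_true] at this
    exact ⟨_, this.symm⟩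
  have huu : IsUnit u := by
    by_contra hu'
    have hu0 : u ≠ 0 := by
      rintro rfl
      obtain ⟨f, hf⟩ := exists_detCons_ne_zero hli
      have := hprop' f
      rw [zero_mul] at this
      exact (mul_ne_zero hvu.ne_zero hf) this
    obtain ⟨c, hcirr, hcu⟩ := WfDvdMonoid.exists_irreducible_factor hu' hu0
    have hcp : Prime c := hcirr.prime
    have hprime : (Ideal.span {c}).IsPrime := (Ideal.span_singleton_prime hcp.ne_zero).mpr hcp
    let π := Ideal.Quotient.mk (Ideal.span {c})
    have hπ : ∀ a, π a = 0 ↔ c ∣ a := fun a => by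
      rw [Ideal.Quotient.eq_zero_iff_mem, Ideal.mem_span_singleton]
    have hli' : LinearIndependent (A ⧸ Ideal.span {c}) (fun j i => π (s j i)) := by
      rw [Fintype.linearIndependent_iff]
      intro r hr
      choose q hq using fun j => Ideal.Quotient.mk_surjective (I := Ideal.span {c}) (r j)
      have hdvd : ∀ i, c ∣ (∑ j, q j • s j) i := by
        intro i
        rw [← hπ]
        have := congr_fun hr i
        simp only [Finset.sum_apply, Pi.smul_apply, smul_eq_mul, Pi.zero_apply, ← hq] at this
        simpa only [Finset.sum_apply, Pi.smul_apply, smul_eq_mul, map_sum, map_mul] using this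
      choose w hw using hdvd
      have hw' : ∑ i, w i * g i = 0 := by
        have : c * ∑ i, w i * g i = 0 := by
          rw [Finset.mul_sum]
          simp only [← mul_assoc, ← hw, Finset.sum_apply, Pi.smul_apply, smul_eq_mul,
            Finset.sum_mul]
          rw [Finset.sum_comm]
          refine Finset.sum_eq_zero fun j _ => ?_
          simp only [mul_assoc, ← Finset.mul_sum, hs, mul_zero]
        exact (mul_eq_zero.mp this).resolve_left hcp.ne_zero
      obtain ⟨y, hy⟩ := (Submodule.mem_span_range_iff_exists_fun _).mp (hspan w hw')
      intro j
      rw [← hq j]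
      refine (hπ _).mpr ⟨y j, ?_⟩
      have := Fintype.linearIndependent_iff.mp hli (fun j => q j - c * y j) (by
        simp only [sub_smul, mul_smul, Finset.sum_sub_distrib, ← Finset.smul_sum, hy]
        ext1 i
        rw [Pi.sub_apply, hw i]
        simp) j
      linear_combination this
    obtain ⟨f, hf⟩ := exists_detCons_ne_zero hli'
    choose f' hf' using fun i => Ideal.Quotient.mk_surjective (I := Ideal.span {c}) (f i)
    apply hf
    rw [← funext hf', ← map_detCons π s f', hπ]
    have h1 : c ∣ v * detCons s f' := by rw [hprop' f']; exact hcu.mul_right _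
    exact (hvu.dvd_mul_left).mp h1
  obtain ⟨v, rfl⟩ := hvu
  obtain ⟨u, rfl⟩ := huu
  refine ⟨u⁻¹ * v, fun f => ?_⟩
  rw [Units.val_mul, mul_assoc, hprop' f, Units.inv_mul_cancel_left]

end HilbertBurch

/-! ### Depth at the irrelevant ideal -/

section Depth

variable {k : Type*} [Field k]

/-- A weakly regular sequence of length two in the ideal generated by `x` forces
`Ext¹(A/(x), A)` to vanish. -/
theorem exists_eq_mul_of_isWeaklyRegular {A ι : Type*} [CommRing A] [Fintype ι] {x : ι → A}
    {f₁ f₂ : A} {rs : List A} (hreg : RingTheory.Sequence.IsWeaklyRegular A (f₁ :: f₂ :: rs))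
    (h₁ : f₁ ∈ Ideal.span (Set.range x)) (h₂ : f₂ ∈ Ideal.span (Set.range x))
    {n : ι → A} (hn : ∀ i j, x i * n j = x j * n i) : ∃ u, ∀ i, n i = x i * u := by
  rw [RingTheory.Sequence.isWeaklyRegular_cons_iff,
    RingTheory.Sequence.isWeaklyRegular_cons_iff] at hreg
  obtain ⟨r₁, r₂, -⟩ := hreg
  obtain ⟨c, hc⟩ := (Ideal.mem_span_range_iff_exists_fun).mp h₁
  obtain ⟨d, hd⟩ := (Ideal.mem_span_range_iff_exists_fun).mp h₂
  have hφ : ∀ (a : ι → A) j, x j * ∑ i, a i * n i = (∑ i, a i * x i) * n j := by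
    intro a j
    rw [Finset.mul_sum, Finset.sum_mul]
    exact Finset.sum_congr rfl fun i _ => by linear_combination -a i * hn i j
  have h21 : f₂ * ∑ i, c i * n i = f₁ * ∑ i, d i * n i := by
    rw [← hd, Finset.sum_mul, Finset.mul_sum]
    refine Finset.sum_congr rfl fun i _ => ?_
    rw [mul_assoc, hφ, hc]
    ring
  have hmem := (isSMulRegular_quotient_iff_mem_of_smul_mem _ _).mp r₂ (∑ i, c i * n i) (by
    rw [smul_eq_mul, h21]
    exact Submodule.smul_mem_pointwise_smul _ _ _ trivial)
  obtain ⟨u, -, hu⟩ := (Submodule.mem_smul_pointwise_iff_exists _ _ _).mp hmem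
  refine ⟨u, fun i => r₁ ?_⟩
  have := hφ c i
  rw [hc, ← hu] at this
  simp only [smul_eq_mul] at this ⊢
  linear_combination -this

theorem isMaximal_idealOfVars : (idealOfVars (Fin 4) k).IsMaximal := by
  have : idealOfVars (Fin 4) k = RingHom.ker (constantCoeff (σ := Fin 4) (R := k)) := by
    ext f
    exact mem_span_range_X_iff
  rw [this]
  exact RingHom.ker_isMaximal_of_surjective _ fun c => ⟨C c, constantCoeff_C _ c⟩

/-- If `R/I` is Cohen–Macaulay of dimension at least two at the irrelevant ideal, then
`Ext¹(k, R/I) = 0`. -/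
theorem extOneVanishes_of_isCohenMacaulay {I : Ideal (CoordRing k)}
    (hCM : IsCohenMacaulay (CoordRing k ⧸ I)) (hI : I ≤ idealOfVars (Fin 4) k)
    (hdim : 2 ≤ ((idealOfVars (Fin 4) k).map (Ideal.Quotient.mk I)).height) :
    ExtOneVanishes I := by
  have hmax := isMaximal_idealOfVars (k := k)
  set 𝔪 := idealOfVars (Fin 4) k with h𝔪
  have hsurj := Ideal.Quotient.mk_surjective (I := I)
  have hker : RingHom.ker (Ideal.Quotient.mk I) ≤ 𝔪 := by rwa [Ideal.mk_ker]
  have hcomap : (𝔪.map (Ideal.Quotient.mk I)).comap (Ideal.Quotient.mk I) = 𝔪 := by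
    rw [Ideal.comap_map_of_surjective _ hsurj, ← RingHom.ker_eq_comap_bot, sup_eq_left]
    exact hker
  have hmax' : (𝔪.map (Ideal.Quotient.mk I)).IsMaximal :=
    Ideal.IsMaximal.map_of_surjective_of_ker_le hsurj hker
  set M := 𝔪.map (Ideal.Quotient.mk I) with hM
  obtain ⟨rs, hrs, hreg, hlen⟩ := hCM.2 M
  rw [IsLocalization.AtPrime.ringKrullDim_eq_height M (Localization.AtPrime M)] at hlen
  have hlen' : 2 ≤ rs.length := by
    have h1 : ((2 : ℕ∞) : WithBot ℕ∞) ≤ (M.height : WithBot ℕ∞) := WithBot.coe_le_coe.mpr hdim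
    rw [← hlen] at h1
    exact_mod_cast h1
  obtain _ | ⟨f₁, _ | ⟨f₂, rs⟩⟩ := rs
  · simp at hlen'
  · simp at hlen'
  intro n hn
  let ψ : CoordRing k →+* Localization.AtPrime M :=
    (algebraMap (CoordRing k ⧸ I) (Localization.AtPrime M)).comp (Ideal.Quotient.mk I)
  have hspan : IsLocalRing.maximalIdeal (Localization.AtPrime M) =
      Ideal.span (Set.range fun i => ψ (X i)) := by
    have h1 : IsLocalRing.maximalIdeal (Localization.AtPrime M) = 𝔪.map ψ :=
      Localization.AtPrime.map_eq_maximalIdeal.symm.trans (Ideal.map_map _ _)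
    rw [h1, h𝔪, Ideal.map_span, ← Set.range_comp]
    rfl
  obtain ⟨u, hu⟩ := exists_eq_mul_of_isWeaklyRegular (x := fun i => ψ (X i))
    hreg.toIsWeaklyRegular (hspan ▸ hrs f₁ (by simp)) (hspan ▸ hrs f₂ (by simp))
    (n := fun i => ψ (n i)) (fun i j => by
      rw [← map_mul, ← map_mul]
      exact congrArg (algebraMap (CoordRing k ⧸ I) (Localization.AtPrime M))
        (Ideal.Quotient.eq.mpr (hn i j)))
  -- clear denominators
  obtain ⟨b, t, rfl⟩ := IsLocalization.exists_mk'_eq M.primeCompl u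
  have hloc : ∀ i, ∃ c : M.primeCompl, (c : CoordRing k ⧸ I) *
      ((t : CoordRing k ⧸ I) * Ideal.Quotient.mk I (n i) - Ideal.Quotient.mk I (X i) * b) = 0 := by
    intro i
    have h1 : algebraMap (CoordRing k ⧸ I) (Localization.AtPrime M)
        ((t : CoordRing k ⧸ I) * Ideal.Quotient.mk I (n i)) =
        algebraMap _ _ (Ideal.Quotient.mk I (X i) * b) := by
      have h2 := hu i
      simp only [ψ, RingHom.comp_apply] at h2
      rw [map_mul, map_mul, h2, mul_left_comm, IsLocalization.mk'_spec'_mk]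
    obtain ⟨c, hc⟩ := (IsLocalization.eq_iff_exists M.primeCompl _).mp h1
    exact ⟨c, by rw [mul_sub, hc, sub_self]⟩
  choose c hc using hloc
  have hexists : ∃ (T B : CoordRing k), constantCoeff T ≠ 0 ∧ ∀ i, T * n i - X i * B ∈ I := by
    obtain ⟨T, hT⟩ := hsurj ((∏ i, (c i : CoordRing k ⧸ I)) * t)
    obtain ⟨B, hB⟩ := hsurj ((∏ i, (c i : CoordRing k ⧸ I)) * b)
    refine ⟨T, B, fun h0 => ?_, fun i => ?_⟩
    · have h1 : T ∈ 𝔪 := mem_span_range_X_iff.mpr h0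
      rw [← hcomap, Ideal.mem_comap, hT] at h1
      have h2 : (∏ i, (c i : CoordRing k ⧸ I)) * t ∈ M.primeCompl :=
        mul_mem (prod_mem fun i _ => (c i).2) t.2
      exact h2 h1
    · rw [← Ideal.Quotient.eq_zero_iff_mem, map_sub, map_mul, map_mul, hT, hB,
        ← Finset.mul_prod_erase _ _ (Finset.mem_univ i)]
      linear_combination (∏ x ∈ Finset.univ.erase i, (c x : CoordRing k ⧸ I)) * hc i
  -- the obstruction is killed by the variables, so only the constant term of the denominator counts
  obtain ⟨T, B, hT0, hTB⟩ := hexists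
  obtain ⟨v, hv⟩ : ∃ v : Fin 4 → CoordRing k, ∑ a, v a * X a = T - C (constantCoeff T) := by
    refine (Ideal.mem_span_range_iff_exists_fun).mp (mem_span_range_X_iff.mpr ?_)
    simp
  refine ⟨C (constantCoeff T)⁻¹ * (B - ∑ a, v a * n a), fun i => ?_⟩
  have hC : C (constantCoeff T)⁻¹ * C (constantCoeff T) = (1 : CoordRing k) := by
    rw [← C_mul, inv_mul_cancel₀ hT0, C_1]
  have hkey : C (constantCoeff T) * n i - X i * (B - ∑ a, v a * n a) ∈ I := by
    have h1 : C (constantCoeff T) * n i - X i * (B - ∑ a, v a * n a) =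
        (T * n i - X i * B) - ∑ a, v a * (X a * n i - X i * n a) := by
      have : ∑ a, v a * (X a * n i - X i * n a) =
          (∑ a, v a * X a) * n i - X i * ∑ a, v a * n a := by
        rw [Finset.sum_mul, Finset.mul_sum, ← Finset.sum_sub_distrib]
        exact Finset.sum_congr rfl fun a _ => by ring
      rw [this, hv]
      ring
    rw [h1]
    exact sub_mem (hTB i) (Ideal.sum_mem _ fun a _ => Ideal.mul_mem_left _ _ (hn a i))
  have := Ideal.mul_mem_left I (C (constantCoeff T)⁻¹) hkey
  have h2 : C (constantCoeff T)⁻¹ * (C (constantCoeff T) * n i - X i * (B - ∑ a, v a * n a)) =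
      n i - X i * (C (constantCoeff T)⁻¹ * (B - ∑ a, v a * n a)) := by
    linear_combination n i * hC
  rwa [h2] at this

end Depth

/-! ### Dimension of subschemes of projective space -/

section Dimension

variable {k : Type*} [Field k]

theorem toIdeal_irrelevant_stdGrading :
    (HomogeneousIdeal.irrelevant (stdGrading k)).toIdeal = idealOfVars (Fin 4) k := by
  ext f
  rw [mem_span_range_X_iff]
  have h : GradedRing.proj (stdGrading k) 0 f = homogeneousComponent 0 f :=
    decomposition.decompose'_apply f 0
  rw [HomogeneousIdeal.mem_iff, HomogeneousIdeal.mem_irrelevant_iff, h, homogeneousComponent_zero,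
    C_eq_zero, constantCoeff_eq]

theorem le_idealOfVars_of_isHomogeneous {J : Ideal (CoordRing k)}
    (hJ : J.IsHomogeneous (stdGrading k)) (h : J ≠ ⊤) : J ≤ idealOfVars (Fin 4) k := by
  intro f hf
  rw [mem_span_range_X_iff]
  by_contra h0
  apply h
  have h1 : homogeneousComponent 0 f ∈ J := by
    have := hJ 0 hf
    rwa [show (DirectSum.decompose (stdGrading k) f 0 : CoordRing k) = homogeneousComponent 0 f
      from decomposition.decompose'_apply f 0] at this
  rw [homogeneousComponent_zero] at h1
  refine Ideal.eq_top_of_isUnit_mem _ h1 ?_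
  rw [constantCoeff_eq] at h0
  exact (IsUnit.mk0 _ h0).map C

/-- The homogeneous ideal of an irreducible subset of a projective spectrum is prime. -/
theorem isPrime_vanishingIdeal {A σ : Type*} [CommRing A] [SetLike σ A] [AddSubmonoidClass σ A]
    {𝒜 : ℕ → σ} [GradedRing 𝒜] {t : Set (ProjectiveSpectrum 𝒜)} (ht : IsIrreducible t) :
    (ProjectiveSpectrum.vanishingIdeal t).toIdeal.IsPrime := by
  have hmem : ∀ f : A, f ∈ (ProjectiveSpectrum.vanishingIdeal t).toIdeal ↔
      t ⊆ ProjectiveSpectrum.zeroLocus 𝒜 {f} := by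
    intro f
    rw [ProjectiveSpectrum.subset_zeroLocus_iff_subset_vanishingIdeal, Set.singleton_subset_iff]
    rfl
  constructor
  · rw [Ideal.ne_top_iff_one, hmem, ProjectiveSpectrum.zeroLocus_singleton_one]
    exact fun h => ht.nonempty.ne_empty (Set.subset_empty_iff.mp h)
  · intro f g hfg
    rw [hmem, ProjectiveSpectrum.zeroLocus_singleton_mul] at hfg
    rw [hmem, hmem]
    exact isPreirreducible_iff_isClosed_union_isClosed.mp ht.isPreirreducible _ _
      (ProjectiveSpectrum.isClosed_zeroLocus _ _) (ProjectiveSpectrum.isClosed_zeroLocus _ _) hfg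

/-- A chain of length one of irreducible closed subsets of `V₊(I)` gives one of relevant
homogeneous primes containing `I`. -/
theorem exists_lt_of_one_le_topologicalKrullDim {I : Ideal (CoordRing k)}
    (h : 1 ≤ topologicalKrullDim
      (ProjectiveSpectrum.zeroLocus (stdGrading k) (I : Set (CoordRing k)))) :
    ∃ p q : Ideal (CoordRing k), p.IsPrime ∧ q.IsPrime ∧ I ≤ p ∧ p < q ∧
      q < idealOfVars (Fin 4) k := by
  obtain ⟨Z₁, Z₂, hlt⟩ := Order.one_le_krullDim_iff.mp h
  let T := ProjectiveSpectrum.zeroLocus (stdGrading k) (I : Set (CoordRing k))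
  let P : TopologicalSpace.IrreducibleCloseds T → HomogeneousIdeal (stdGrading k) := fun Z =>
    ProjectiveSpectrum.vanishingIdeal (Subtype.val '' (Z : Set T))
  have hprime : ∀ Z, (P Z).toIdeal.IsPrime := fun Z =>
    isPrime_vanishingIdeal (Z.isIrreducible.image _ continuous_subtype_val.continuousOn)
  have hle : ∀ Z, ∀ x ∈ Z, P Z ≤ x.1.asHomogeneousIdeal := by
    intro Z x hx f hf
    exact (ProjectiveSpectrum.mem_vanishingIdeal _ f).mp hf x.1 ⟨x, hx, rfl⟩
  have hI : ∀ Z, I ≤ (P Z).toIdeal := by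
    intro Z f hf
    refine (ProjectiveSpectrum.mem_vanishingIdeal _ f).mpr ?_
    rintro _ ⟨x, -, rfl⟩
    exact x.2 hf
  have hanti : P Z₂ ≤ P Z₁ :=
    ProjectiveSpectrum.vanishingIdeal_anti_mono _ (Set.image_mono hlt.le)
  have hne : ¬ P Z₁ ≤ P Z₂ := by
    intro h12
    apply hlt.not_ge
    intro x hx
    rw [← SetLike.mem_coe, ← Z₁.isClosed.closure_eq]
    rw [closure_subtype, ← ProjectiveSpectrum.zeroLocus_vanishingIdeal_eq_closure]
    exact h12.trans (hle Z₂ x hx)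
  refine ⟨(P Z₂).toIdeal, (P Z₁).toIdeal, hprime _, hprime _, hI _,
    lt_of_le_not_ge hanti hne, lt_of_le_not_ge ?_ ?_⟩
  · exact le_idealOfVars_of_isHomogeneous (P Z₁).isHomogeneous (hprime Z₁).ne_top
  · intro hle'
    obtain ⟨x, hx⟩ := Z₁.isIrreducible.nonempty
    apply x.1.not_irrelevant_le
    rw [← toIdeal_irrelevant_stdGrading] at hle'
    exact le_trans hle' (hle Z₁ x hx)

/-- A chain of length two of relevant homogeneous primes containing `I` shows that `V₊(I)` has
dimension at least two. -/
theorem two_le_topologicalKrullDim {I p₀ p₁ p₂ : Ideal (CoordRing k)}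
    (h₀ : p₀.IsHomogeneous (stdGrading k)) (h₁ : p₁.IsHomogeneous (stdGrading k))
    (h₂ : p₂.IsHomogeneous (stdGrading k)) [p₀.IsPrime] [p₁.IsPrime] [p₂.IsPrime]
    (hI : I ≤ p₀) (h01 : p₀ < p₁) (h12 : p₁ < p₂) (hm : ¬ idealOfVars (Fin 4) k ≤ p₂) :
    2 ≤ topologicalKrullDim
      (ProjectiveSpectrum.zeroLocus (stdGrading k) (I : Set (CoordRing k))) := by
  rw [← toIdeal_irrelevant_stdGrading] at hm
  let T := ProjectiveSpectrum.zeroLocus (stdGrading k) (I : Set (CoordRing k))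
  let mk : (p : Ideal (CoordRing k)) → (hp : p.IsHomogeneous (stdGrading k)) → p.IsPrime →
      I ≤ p → p ≤ p₂ → T := fun p hp hpp hIp hpp₂ =>
    ⟨⟨⟨p, hp⟩, hpp, fun h => hm (le_trans h hpp₂)⟩, hIp⟩
  let y₀ : T := mk p₀ h₀ inferInstance hI (h01.trans h12).le
  let y₁ : T := mk p₁ h₁ inferInstance (hI.trans h01.le) h12.le
  let y₂ : T := mk p₂ h₂ inferInstance (hI.trans (h01.trans h12).le) le_rfl
  let Z : T → TopologicalSpace.IrreducibleCloseds T := fun y =>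
    ⟨closure {y}, isIrreducible_singleton.closure, isClosed_closure⟩
  have hmem : ∀ y z : T, z ∈ closure ({y} : Set T) ↔ y.1 ≤ z.1 := by
    intro y z
    rw [closure_subtype, Set.image_singleton, ProjectiveSpectrum.le_iff_mem_closure]
  have hlt : ∀ y z : T, y.1 < z.1 → Z z < Z y := by
    intro y z hyz
    refine lt_of_le_not_ge (fun w hw => ?_) fun h => ?_
    · exact (hmem y w).mpr (hyz.le.trans ((hmem z w).mp hw))
    · have : y ∈ closure ({z} : Set T) := h ((hmem y y).mpr le_rfl)
      exact hyz.not_ge ((hmem z y).mp this)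
  let L : LTSeries (TopologicalSpace.IrreducibleCloseds T) :=
    ⟨2, ![Z y₂, Z y₁, Z y₀], by
      intro i
      fin_cases i
      · exact hlt y₁ y₂ h12
      · exact hlt y₀ y₁ h01⟩
  exact Order.LTSeries.length_le_krullDim L

theorem isHomogeneous_of_mem_minimalPrimes {J p : Ideal (CoordRing k)}
    (hJ : J.IsHomogeneous (stdGrading k)) (hp : p ∈ J.minimalPrimes) :
    p.IsHomogeneous (stdGrading k) := by
  have hprime := hp.1.1
  rw [Ideal.IsHomogeneous.iff_eq]
  refine le_antisymm (Ideal.toIdeal_homogeneousCore_le _ _) (hp.2 ⟨hprime.homogeneousCore, ?_⟩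
    (Ideal.toIdeal_homogeneousCore_le _ _))
  rw [← hJ.toIdeal_homogeneousCore_eq_self]
  exact Ideal.homogeneousCore_mono _ hp.1.2

/-- The substitution of zero for the variables in `s`. -/
noncomputable def killVars (s : Finset (Fin 4)) : CoordRing k →ₐ[k] CoordRing k :=
  aeval fun i => if i ∈ s then 0 else X i

theorem killVars_X (s : Finset (Fin 4)) (i : Fin 4) :
    killVars (k := k) s (X i) = if i ∈ s then 0 else X i := by
  simp [killVars]

theorem ker_killVars_lt {s t : Finset (Fin 4)} (h : s < t) :
    RingHom.ker (killVars (k := k) s) < RingHom.ker (killVars (k := k) t) := by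
  refine lt_of_le_not_ge (fun f hf => ?_) fun hle => ?_
  · have hcomp : (killVars (k := k) t).comp (killVars s) = killVars t := by
      ext i : 1
      rw [AlgHom.comp_apply, killVars_X, killVars_X]
      split_ifs with h1 h2 h2
      · rw [map_zero]
      · exact absurd (h.le h1) h2
      · rw [killVars_X, if_pos h2]
      · rw [killVars_X, if_neg h2]
    rw [RingHom.mem_ker] at hf ⊢
    rw [← hcomp, AlgHom.comp_apply, hf, map_zero]
  · obtain ⟨i, hit, his⟩ := Finset.exists_of_ssubset h
    have : (X i : CoordRing k) ∈ RingHom.ker (killVars (k := k) s) :=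
      hle (by rw [RingHom.mem_ker, killVars_X, if_pos hit])
    rw [RingHom.mem_ker, killVars_X, if_neg his] at this
    exact X_ne_zero _ this

theorem four_le_height_idealOfVars : 4 ≤ (idealOfVars (Fin 4) k).height := by
  have hprime : ∀ s : Finset (Fin 4), (RingHom.ker (killVars (k := k) s)).IsPrime := fun s =>
    RingHom.ker_isPrime _
  have hstep : ∀ {s t : Finset (Fin 4)}, s < t →
      (RingHom.ker (killVars (k := k) s)).height + 1 ≤ (RingHom.ker (killVars (k := k) t)).height :=
    fun {s t} h => Ideal.height_add_one_le_of_lt_of_isPrime (ker_killVars_lt h)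
  have htop : RingHom.ker (killVars (k := k) Finset.univ) ≤ idealOfVars (Fin 4) k := by
    intro f hf
    rw [mem_span_range_X_iff]
    have h1 : (constantCoeff (σ := Fin 4) (R := k)).comp (killVars Finset.univ).toRingHom =
        constantCoeff := by
      ext i <;> simp [killVars]
    rw [← h1]
    rw [RingHom.mem_ker] at hf
    simp [hf]
  have e1 := hstep (s := ∅) (t := {0}) (by decide)
  have e2 := hstep (s := {0}) (t := {0, 1}) (by decide)
  have e3 := hstep (s := {0, 1}) (t := {0, 1, 2}) (by decide)
  have e4 := hstep (s := {0, 1, 2}) (t := Finset.univ) (by decide)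
  have e5 := Ideal.height_mono htop
  calc (4 : ℕ∞) = 0 + 1 + 1 + 1 + 1 := by norm_num
    _ ≤ (RingHom.ker (killVars (k := k) ∅)).height + 1 + 1 + 1 + 1 := by gcongr; exact zero_le
    _ ≤ (RingHom.ker (killVars (k := k) {0})).height + 1 + 1 + 1 := by gcongr
    _ ≤ (RingHom.ker (killVars (k := k) {0, 1})).height + 1 + 1 := by gcongr
    _ ≤ (RingHom.ker (killVars (k := k) {0, 1, 2})).height + 1 := by gcongr
    _ ≤ _ := e4
    _ ≤ _ := e5

/-- A prime minimal over `(c, xᵢ)` is generated by `xᵢ` and one more element, because `R/(xᵢ)` is a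
polynomial ring, hence factorial. -/
theorem exists_eq_span_pair_of_mem_minimalPrimes {c : CoordRing k} {i : Fin 4}
    {q : Ideal (CoordRing k)} (hq : q ∈ (Ideal.span {c, X i}).minimalPrimes) :
    ∃ c', q = Ideal.span {c', X i} := by
  have hprime := hq.1.1
  let ι : {j : Fin 4 // j ≠ i} → Fin 4 := Subtype.val
  have hι : Function.Injective ι := Subtype.val_injective
  let κ : CoordRing k →ₐ[k] MvPolynomial {j : Fin 4 // j ≠ i} k := killCompl hι
  have hsurj : Function.Surjective κ := fun f => ⟨rename ι f, killCompl_rename_app hι f⟩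
  have hκi : κ (X i) = 0 := by
    simp [κ, killCompl, ι]
  have hker : ∀ f, f - rename ι (κ f) ∈ Ideal.span {(X i : CoordRing k)} := by
    intro f
    induction f using MvPolynomial.induction_on with
    | C a => simp [κ]
    | add f g hf hg =>
      rw [map_add, map_add, add_sub_add_comm]
      exact add_mem hf hg
    | mul_X f j hf =>
      by_cases hj : j = i
      · subst hj
        rw [map_mul, hκi, mul_zero, map_zero, sub_zero]
        exact Ideal.mul_mem_left _ _ (Ideal.mem_span_singleton_self _)
      · have hκj : rename ι (κ (X j)) = X j := by
          have : κ (X j) = X ⟨j, hj⟩ := by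
            rw [← killCompl_rename_app hι (X ⟨j, hj⟩ : MvPolynomial {j : Fin 4 // j ≠ i} k),
              rename_X]
          rw [this, rename_X]
        rw [map_mul, map_mul, hκj, ← sub_mul]
        exact Ideal.mul_mem_right _ _ hf
  have hXi : (X i : CoordRing k) ∈ q := hq.1.2 (Ideal.subset_span (by simp))
  have hker' : RingHom.ker κ ≤ Ideal.span {(X i : CoordRing k)} := fun f hf => by
    have := hker f
    rwa [(RingHom.mem_ker).mp hf, map_zero, sub_zero] at this
  have hkerq : RingHom.ker κ ≤ q :=
    hker'.trans ((Ideal.span_singleton_le_iff_mem _).mpr hXi)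
  have hcomap : (q.map κ).comap κ = q := by
    rw [Ideal.comap_map_of_surjective κ hsurj, ← RingHom.ker_eq_comap_bot, sup_eq_left]
    exact hkerq
  have hprime' : (q.map κ).IsPrime := Ideal.map_isPrime_of_surjective hsurj hkerq
  have hmin : q.map κ ∈ (Ideal.span {κ c}).minimalPrimes := by
    refine ⟨⟨hprime', ?_⟩, fun r hr hrq => ?_⟩
    · rw [Ideal.span_singleton_le_iff_mem]
      exact Ideal.mem_map_of_mem κ (hq.1.2 (Ideal.subset_span (by simp)))
    · have hr1 := hr.1
      refine Ideal.map_le_iff_le_comap.mpr (hq.2 ⟨inferInstance, ?_⟩ ?_)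
      · rw [Ideal.span_le]
        rintro _ (rfl | rfl)
        · exact hr.2 (Ideal.mem_span_singleton_self _)
        · rw [SetLike.mem_coe, Ideal.mem_comap, hκi]
          exact zero_mem _
      · rw [← hcomap]
        exact Ideal.comap_mono hrq
  have hht : (q.map κ).height ≤ 1 :=
    Ideal.height_le_one_of_isPrincipal_of_mem_minimalPrimes _ _ hmin
  obtain ⟨a, ha⟩ : ∃ a, q.map κ = Ideal.span {a} := by
    by_cases h0 : q.map κ = ⊥
    · exact ⟨0, by rw [h0, Ideal.span_singleton_eq_bot.mpr rfl]⟩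
    · obtain ⟨a, ha, hap⟩ := hprime'.exists_mem_prime_of_ne_bot h0
      refine ⟨a, Ideal.eq_span_singleton_of_height_eq_one (le_antisymm hht ?_) ha hap⟩
      rw [Order.one_le_iff_ne_zero, Ne, Ideal.height_eq_zero_iff_eq_bot]
      exact h0
  obtain ⟨c', rfl⟩ := hsurj a
  refine ⟨c', le_antisymm (fun f hf => ?_) ?_⟩
  · have h1 : κ f ∈ Ideal.span {κ c'} := ha ▸ Ideal.mem_map_of_mem κ hf
    obtain ⟨b, hb⟩ := Ideal.mem_span_singleton'.mp h1
    obtain ⟨b', rfl⟩ := hsurj b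
    have h2 : f - b' * c' ∈ Ideal.span {(X i : CoordRing k)} :=
      hker' (by rw [RingHom.mem_ker, map_sub, map_mul, hb, sub_self])
    obtain ⟨y, hy⟩ := Ideal.mem_span_singleton'.mp h2
    exact Ideal.mem_span_pair.mpr ⟨b', y, by rw [hy]; ring⟩
  · rw [Ideal.span_le]
    rintro _ (rfl | rfl)
    · rw [← hcomap]
      exact ha ▸ Ideal.mem_span_singleton_self _
    · exact hXi

/-- A closed subscheme of dimension one of `ℙ³` is not contained in a prime of height one. The
proof exhibits a chain of relevant homogeneous primes `p < q < q'`, where `q` is minimal over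
`p + (xᵢ)` and `q'` over `q + (xⱼ)`; as `q'` is minimal over an ideal with three generators, it is
not the irrelevant ideal. -/
theorem not_le_of_height_le_one {I : Ideal (CoordRing k)}
    (hI : I.IsHomogeneous (stdGrading k)) (hI0 : I ≠ ⊥)
    (hdim : topologicalKrullDim
      (ProjectiveSpectrum.zeroLocus (stdGrading k) (I : Set (CoordRing k))) = 1)
    {P : Ideal (CoordRing k)} [hP : P.IsPrime] (hht : P.height ≤ 1) : ¬ I ≤ P := by
  intro hIP
  have h4 := four_le_height_idealOfVars (k := k)
  -- replace `P` by its homogeneous core `p = (c)`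
  let p := (P.homogeneousCore (stdGrading k)).toIdeal
  have hpp : p.IsPrime := hP.homogeneousCore
  have hph : p.IsHomogeneous (stdGrading k) := (P.homogeneousCore (stdGrading k)).isHomogeneous
  have hIp : I ≤ p := by
    rw [← hI.toIdeal_homogeneousCore_eq_self]
    exact Ideal.homogeneousCore_mono _ hIP
  have hp1 : p.height ≤ 1 := (Ideal.height_mono (Ideal.toIdeal_homogeneousCore_le _ _)).trans hht
  have hp0 : p ≠ ⊥ := fun h => hI0 (le_bot_iff.mp (h ▸ hIp))
  obtain ⟨c, hc, hcp⟩ := hpp.exists_mem_prime_of_ne_bot hp0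
  have hpc : p = Ideal.span {c} := by
    refine Ideal.eq_span_singleton_of_height_eq_one (le_antisymm hp1 ?_) hc hcp
    rw [Order.one_le_iff_ne_zero, Ne, Ideal.height_eq_zero_iff_eq_bot]
    exact hp0
  have hvar : ∀ q : Ideal (CoordRing k), q.height ≤ 3 → ∃ i, (X i : CoordRing k) ∉ q := by
    intro q hq
    by_contra! hall
    have : idealOfVars (Fin 4) k ≤ q := by
      rw [Ideal.span_le]
      rintro _ ⟨i, rfl⟩
      exact hall i
    have := h4.trans ((Ideal.height_mono this).trans hq)
    exact absurd this (by decide)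
  have hXh : ∀ i, (Ideal.span {(X i : CoordRing k)}).IsHomogeneous (stdGrading k) := by
    intro i
    refine Ideal.homogeneous_span _ _ ?_
    rintro _ rfl
    exact ⟨1, isHomogeneous_X k i⟩
  have hmem4 : ∀ i, (X i : CoordRing k) ∈ idealOfVars (Fin 4) k := fun i =>
    Ideal.subset_span ⟨i, rfl⟩
  have hne : ∀ {J : Ideal (CoordRing k)}, J.IsHomogeneous (stdGrading k) → J.IsPrime → ∀ i,
      J ⊔ Ideal.span {X i} ≠ ⊤ := by
    intro J hJ hJp i h
    apply (isMaximal_idealOfVars (k := k)).ne_top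
    rw [← top_le_iff, ← h]
    exact sup_le (le_idealOfVars_of_isHomogeneous hJ hJp.ne_top)
      ((Ideal.span_singleton_le_iff_mem _).mpr (hmem4 i))
  obtain ⟨i, hi⟩ := hvar p (hp1.trans (by decide))
  obtain ⟨q, hq⟩ := Ideal.nonempty_minimalPrimes (hne hph hpp i)
  have hqp : q.IsPrime := hq.1.1
  have hqh := isHomogeneous_of_mem_minimalPrimes (hph.sup (hXh i)) hq
  have hpi : p ⊔ Ideal.span {X i} = Ideal.span {c, X i} := by
    rw [hpc, ← Ideal.span_union, Set.singleton_union]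
  obtain ⟨c', hc'⟩ := exists_eq_span_pair_of_mem_minimalPrimes (hpi ▸ hq)
  have hpq : p < q := lt_of_le_not_ge (le_sup_left.trans hq.1.2) fun h =>
    hi (h (hq.1.2 (Ideal.mem_sup_right (Ideal.mem_span_singleton_self _))))
  have hq2 : q.height ≤ 2 := by
    have := Ideal.height_le_card_of_mem_minimalPrimes_span (Set.toFinite _) (hpi ▸ hq)
    refine this.trans ?_
    have h2 : ({c, X i} : Set (CoordRing k)).ncard ≤ 2 :=
      (Set.ncard_insert_le _ _).trans (by rw [Set.ncard_singleton])
    exact_mod_cast h2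
  obtain ⟨j, hj⟩ := hvar q (hq2.trans (by decide))
  obtain ⟨q', hq'⟩ := Ideal.nonempty_minimalPrimes (hne hqh hqp j)
  have hqp' : q'.IsPrime := hq'.1.1
  have hqh' := isHomogeneous_of_mem_minimalPrimes (hqh.sup (hXh j)) hq'
  have hqj : q ⊔ Ideal.span {X j} = Ideal.span {X j, c', X i} := by
    rw [hc', ← Ideal.span_union, Set.union_singleton]
  have hqq' : q < q' := lt_of_le_not_ge (le_sup_left.trans hq'.1.2) fun h =>
    hj (h (hq'.1.2 (Ideal.mem_sup_right (Ideal.mem_span_singleton_self _))))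
  have hq3 : q'.height ≤ 3 := by
    have := Ideal.height_le_card_of_mem_minimalPrimes_span (Set.toFinite _) (hqj ▸ hq')
    refine this.trans ?_
    have h3 : ({X j, c', X i} : Set (CoordRing k)).ncard ≤ 3 :=
      (Set.ncard_insert_le _ _).trans (Nat.succ_le_succ
        ((Set.ncard_insert_le _ _).trans (by rw [Set.ncard_singleton])))
    exact_mod_cast h3
  obtain ⟨l, hl⟩ := hvar q' hq3
  have := two_le_topologicalKrullDim hph hqh hqh' hIp hpq hqq' fun h => hl (h (hmem4 l))
  rw [hdim] at this
  exact absurd this (by decide)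

theorem two_le_height_map_idealOfVars {I : Ideal (CoordRing k)}
    (hdim : topologicalKrullDim
      (ProjectiveSpectrum.zeroLocus (stdGrading k) (I : Set (CoordRing k))) = 1) :
    I ≤ idealOfVars (Fin 4) k ∧
      2 ≤ ((idealOfVars (Fin 4) k).map (Ideal.Quotient.mk I)).height := by
  obtain ⟨p, q, hp, hq, hIp, hpq, hqm⟩ := exists_lt_of_one_le_topologicalKrullDim hdim.ge
  have hm := (isMaximal_idealOfVars (k := k)).isPrime
  have hIm := hIp.trans (hpq.trans hqm).le
  have hsurj := Ideal.Quotient.mk_surjective (I := I)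
  have hlt : ∀ {a b : Ideal (CoordRing k)}, I ≤ a → a < b →
      a.map (Ideal.Quotient.mk I) < b.map (Ideal.Quotient.mk I) := by
    intro a b ha hab
    refine lt_of_le_not_ge (Ideal.map_mono hab.le) fun h => hab.not_ge ?_
    have h1 := Ideal.map_le_iff_le_comap.mp h
    rwa [Ideal.comap_map_of_surjective _ hsurj, ← RingHom.ker_eq_comap_bot, Ideal.mk_ker,
      sup_eq_left.mpr ha] at h1
  have hpr : ∀ {a : Ideal (CoordRing k)}, I ≤ a → a.IsPrime →
      (a.map (Ideal.Quotient.mk I)).IsPrime := fun ha hap =>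
    Ideal.map_isPrime_of_surjective hsurj (by rwa [Ideal.mk_ker])
  have hp' := hpr hIp hp
  have hq' := hpr (hIp.trans hpq.le) hq
  have hm' := hpr hIm hm
  have e1 := Ideal.height_add_one_le_of_lt_of_isPrime (hlt hIp hpq)
  have e2 := Ideal.height_add_one_le_of_lt_of_isPrime (hlt (hIp.trans hpq.le) hqm)
  refine ⟨hIm, ?_⟩
  calc (2 : ℕ∞) = 0 + 1 + 1 := by norm_num
    _ ≤ (p.map (Ideal.Quotient.mk I)).height + 1 + 1 := by gcongr; exact zero_le
    _ ≤ (q.map (Ideal.Quotient.mk I)).height + 1 := by gcongr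
    _ ≤ _ := e2

end Dimension

/-! ### Determinantal presentations -/

section Determinantal

variable {k : Type*} [Field k]

theorem Matrix.exists_perm_forall_ne_zero_of_det_ne_zero {n A : Type*} [Fintype n] [DecidableEq n]
    [CommRing A] {M : Matrix n n A} (h : M.det ≠ 0) : ∃ σ : Equiv.Perm n, ∀ j, M (σ j) j ≠ 0 := by
  rw [Matrix.det_apply] at h
  obtain ⟨σ, -, hσ⟩ := Finset.exists_ne_zero_of_sum_ne_zero h
  refine ⟨σ, fun j hj => hσ ?_⟩
  have h0 : ∏ i, M (σ i) i = 0 := Finset.prod_eq_zero (Finset.mem_univ j) hj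
  rw [h0, smul_zero]

/-- A square matrix over `k[x, y, z, w]` with entries homogeneous of degree `b j - a i`, where the
entries of degree `≤ 0` vanish and which has nonzero determinant `F`, gives a weak determinantal
presentation of `F`, after sorting rows and columns. -/
theorem exists_isWeakDeterminantal_of_det_eq {d t : ℕ} {F : CoordRing k} (hF : F.IsHomogeneous d)
    (hF0 : F ≠ 0) (ht : 2 ≤ t) {a b : Fin t → ℤ} {M : Matrix (Fin t) (Fin t) (CoordRing k)}
    (hpos : ∀ i j, a i < b j → (M i j).IsHomogeneous (b j - a i).toNat)
    (hneg : ∀ i j, b j ≤ a i → M i j = 0) {u : k} (hdet : F = C u * M.det) :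
    ∃ (t : ℕ) (a b : Fin t → ℤ),
      IsWeakAdmissiblePair a b ∧ pairDegree a b = d ∧ IsWeakDeterminantal F a b := by
  classical
  have hM : M.det ≠ 0 := by
    intro h
    rw [h, mul_zero] at hdet
    exact hF0 hdet
  -- the degree of the determinant
  have hdeg : ∑ j, b j - ∑ i, a i = d := by
    have hterm : ∀ σ : Equiv.Perm (Fin t), ∏ j, M (σ j) j ≠ 0 →
        (∏ j, M (σ j) j).IsHomogeneous (∑ j, b j - ∑ i, a i).toNat ∧
          0 ≤ ∑ j, b j - ∑ i, a i := by
      intro σ hσ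
      have hlt : ∀ j, a (σ j) < b j := fun j => by
        by_contra! hle
        exact hσ (Finset.prod_eq_zero (Finset.mem_univ j) (hneg _ _ hle))
      have hsum : ∑ j, b j - ∑ i, a i = ((∑ j, (b j - a (σ j)).toNat : ℕ) : ℤ) := by
        rw [Nat.cast_sum, ← Equiv.sum_comp σ a, ← Finset.sum_sub_distrib]
        refine Finset.sum_congr rfl fun j _ => (Int.toNat_of_nonneg ?_).symm
        have := hlt j
        omega
      rw [hsum, Int.toNat_natCast]
      exact ⟨IsHomogeneous.prod _ _ _ fun j _ => hpos _ _ (hlt j), Int.natCast_nonneg _⟩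
    have hhom : M.det.IsHomogeneous (∑ j, b j - ∑ i, a i).toNat := by
      rw [Matrix.det_apply]
      refine IsHomogeneous.sum _ _ _ fun σ _ => ?_
      by_cases hσ : ∏ j, M (σ j) j = 0
      · rw [hσ, smul_zero]
        exact isHomogeneous_zero _ _ _
      · rcases Int.units_eq_one_or (Equiv.Perm.sign σ) with h | h
        · rw [h, one_smul]
          exact (hterm σ hσ).1
        · rw [h, Units.neg_smul, one_smul]
          exact (hterm σ hσ).1.neg
    have hd := (hdet ▸ hhom.C_mul u : F.IsHomogeneous _).inj_right hF hF0
    obtain ⟨σ, hσ⟩ := Matrix.exists_perm_forall_ne_zero_of_det_ne_zero hM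
    have := (hterm σ (Finset.prod_ne_zero_iff.mpr fun j _ => hσ j)).2
    omega
  -- sort the rows and columns, and move the unit into the first column
  let τ := Tuple.sort a
  let ρ := Tuple.sort b
  let N : Matrix (Fin t) (Fin t) (CoordRing k) := M.submatrix τ ρ
  obtain ⟨v, hv, hv0⟩ : ∃ v : k, F = C v * N.det ∧ N.det ≠ 0 := by
    have hN : N.det = (Equiv.Perm.sign τ : ℤ) * ((Equiv.Perm.sign ρ : ℤ) * M.det) := by
      rw [← Matrix.det_permute' ρ M, ← Matrix.det_permute τ]
      rfl
    rcases Int.units_eq_one_or (Equiv.Perm.sign τ) with h1 | h1 <;>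
    rcases Int.units_eq_one_or (Equiv.Perm.sign ρ) with h2 | h2 <;>
    rw [h1, h2] at hN <;> simp at hN
    · exact ⟨u, by rw [hN, hdet], by rwa [hN]⟩
    · exact ⟨-u, by rw [hN, hdet, C_neg]; ring, by rw [hN]; exact neg_ne_zero.mpr hM⟩
    · exact ⟨-u, by rw [hN, hdet, C_neg]; ring, by rw [hN]; exact neg_ne_zero.mpr hM⟩
    · exact ⟨u, by rw [hN, hdet], by rwa [hN]⟩
  have ha : Monotone (a ∘ τ) := Tuple.monotone_sort a
  have hb : Monotone (b ∘ ρ) := Tuple.monotone_sort b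
  have hadm : IsWeakAdmissiblePair (a ∘ τ) (b ∘ ρ) := by
    refine ⟨ht, ha, hb, fun i => ?_⟩
    -- otherwise `N` has a block of zeros of size `(t - i) × (i + 1)`
    by_contra! hle
    obtain ⟨σ, hσ⟩ := Matrix.exists_perm_forall_ne_zero_of_det_ne_zero hv0
    have hmaps : ∀ j ∈ Finset.Iic i, σ j ∈ Finset.Iio i := by
      intro j hj
      rw [Finset.mem_Iio]
      rw [Finset.mem_Iic] at hj
      by_contra! hi
      exact hσ j (hneg _ _ ((hb hj).trans (hle.trans (ha hi))))
    have := Finset.card_le_card_of_injOn σ hmaps σ.injective.injOn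
    rw [Fin.card_Iic, Fin.card_Iio] at this
    omega
  refine ⟨t, a ∘ τ, b ∘ ρ, hadm, ?_, hadm, ?_⟩
  · rw [pairDegree, Finset.sum_sub_distrib, ← hdeg]
    congr 1
    · exact Equiv.sum_comp ρ b
    · exact Equiv.sum_comp τ a
  · let j₀ : Fin t := ⟨0, by omega⟩
    have hentry : ∀ i j, N.updateCol j₀ ((C v : CoordRing k) • fun i => N i j₀) i j =
        C (if j = j₀ then v else 1) * N i j := by
      intro i j
      by_cases hj : j = j₀
      · subst hj
        simp
      · simp [hj]
    refine ⟨N.updateCol j₀ ((C v : CoordRing k) • fun i => N i j₀), fun i j hij => ?_,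
      fun i j hij => ?_, ?_⟩
    · rw [hentry]
      exact (hpos _ _ hij).C_mul _
    · rw [hentry, show N i j = 0 from hneg _ _ hij, mul_zero]
    · rw [Matrix.det_updateCol_smul, Matrix.updateCol_eq_self, hv]

theorem eq_C_of_constantCoeff_ne_zero {f : CoordRing k} {n : ℕ}
    (hf : f.IsHomogeneous n) (h : constantCoeff f ≠ 0) : f = C (constantCoeff f) := by
  have h0 : n = 0 := by
    by_contra hn
    exact h (by rw [constantCoeff_eq]; exact hf.coeff_eq_zero (by simpa using Ne.symm hn))
  subst h0
  exact (homogeneousComponent_eq_self hf).symm.trans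
    (by rw [homogeneousComponent_zero, constantCoeff_eq])

/-- Among the minimal systems of homogeneous generators of `I`, there is one that either contains
`F`, or expresses `F` with coefficients in the irrelevant ideal. -/
theorem exists_generators_adapted {I : Ideal (CoordRing k)}
    (hI : I.IsHomogeneous (stdGrading k)) {d : ℕ} {F : CoordRing k} (hF : F.IsHomogeneous d)
    (hFI : F ∈ I) :
    ∃ (N : ℕ) (g : Fin N → CoordRing k) (e : Fin N → ℕ), (∀ i, (g i).IsHomogeneous (e i)) ∧
      Ideal.span (Set.range g) = I ∧ (∀ j, g j ∉ Ideal.span (g '' {j}ᶜ)) ∧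
      ((∃ i, g i = F) ∨ ∃ f : Fin N → CoordRing k, IsShiftedHomogeneous e d f ∧
        ∑ i, f i * g i = F ∧ ∀ i, constantCoeff (f i) = 0) := by
  classical
  obtain ⟨N, g, hg, hspan, hmin⟩ := exists_minimal_generators (A := CoordRing k)
    {f | f ∈ I ∧ ∃ n, f.IsHomogeneous n}
  have hH : Submodule.span (CoordRing k) {f | f ∈ I ∧ ∃ n, f.IsHomogeneous n} = I := by
    refine le_antisymm (Submodule.span_le.mpr fun f hf => hf.1) fun f hf => ?_
    rw [← sum_homogeneousComponent f]
    refine Submodule.sum_mem _ fun i _ => Submodule.subset_span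
      ⟨?_, i, homogeneousComponent_isHomogeneous _ _⟩
    have := hI i hf
    rwa [show (DirectSum.decompose (stdGrading k) f i : CoordRing k) = homogeneousComponent i f
      from decomposition.decompose'_apply f i] at this
  choose e he using fun i => (hg i).2
  obtain ⟨f₀, hf₀⟩ : ∃ c : Fin N → CoordRing k, ∑ i, c i * g i = F :=
    (Ideal.mem_span_range_iff_exists_fun).mp (by
      rw [← hH, ← hspan] at hFI
      exact hFI)
  let f := shiftedComponent e d f₀
  have hfh : IsShiftedHomogeneous e d f := isShiftedHomogeneous_shiftedComponent _ _ _
  have hf : ∑ i, f i * g i = F := by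
    rw [← homogeneousComponent_sum_mul he, hf₀]
    exact homogeneousComponent_eq_self hF
  by_cases hc : ∀ i, constantCoeff (f i) = 0
  · exact ⟨N, g, e, he, hspan.trans hH, notMem_span_of_minimal hg hspan hmin,
      Or.inr ⟨f, hfh, hf, hc⟩⟩
  · push Not at hc
    obtain ⟨i₀, hi₀⟩ := hc
    have hle : e i₀ ≤ d := by
      by_contra! h
      rw [(hfh i₀).2 h, map_zero] at hi₀
      exact hi₀ rfl
    have hfC := eq_C_of_constantCoeff_ne_zero ((hfh i₀).1 hle) hi₀
    -- exchange the generator `g i₀` for `F`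
    let g' := Function.update g i₀ F
    have hg' : ∀ i, g' i ∈ {f | f ∈ I ∧ ∃ n, f.IsHomogeneous n} := by
      intro i
      by_cases hi : i = i₀
      · subst hi
        simpa [g'] using ⟨hFI, d, hF⟩
      · simpa [g', hi] using hg i
    have hspan' : Submodule.span (CoordRing k) (Set.range g') =
        Submodule.span (CoordRing k) {f | f ∈ I ∧ ∃ n, f.IsHomogeneous n} := by
      refine le_antisymm (Submodule.span_mono ?_) ?_
      · rintro _ ⟨i, rfl⟩
        exact hg' i
      · rw [← hspan, Submodule.span_le]
        have hother : ∀ i, i ≠ i₀ → g i ∈ Submodule.span (CoordRing k) (Set.range g') :=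
          fun i hi => Submodule.subset_span ⟨i, by simp [g', hi]⟩
        rintro _ ⟨i, rfl⟩
        by_cases hi : i = i₀
        · subst hi
          rw [← Finset.add_sum_erase _ _ (Finset.mem_univ i), hfC] at hf
          have h1 : g i = (C (constantCoeff (f i))⁻¹ : CoordRing k) •
              (F - ∑ j ∈ Finset.univ.erase i, f j * g j) := by
            rw [← hf, add_sub_cancel_right, smul_eq_mul, ← mul_assoc, ← C_mul,
              inv_mul_cancel₀ hi₀, C_1, one_mul]
          rw [h1]
          refine Submodule.smul_mem _ _ (sub_mem (Submodule.subset_span ⟨i, by simp [g']⟩)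
            (Submodule.sum_mem _ fun j hj => Submodule.smul_mem _ _
              (hother j (Finset.mem_erase.mp hj).1)))
        · exact hother i hi
    choose e' he' using fun i => (hg' i).2
    exact ⟨N, g', e', he', hspan'.trans hH, notMem_span_of_minimal hg' hspan' hmin,
      Or.inl ⟨i₀, by simp [g']⟩⟩

theorem SpaceCurve.isCompleteIntersection_of_span_range_eq {C : SpaceCurve k} {N : ℕ}
    (hN : N ≤ 2) {g : Fin N → CoordRing k} {e : Fin N → ℕ} (hg : ∀ i, (g i).IsHomogeneous (e i))
    (hspan : Ideal.span (Set.range g) = C.ideal.toIdeal) : C.IsCompleteIntersection := by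
  interval_cases N
  · refine ⟨0, 0, 0, 0, isHomogeneous_zero _ _ _, isHomogeneous_zero _ _ _, ?_⟩
    rw [← hspan]
    simp
  · refine ⟨g 0, 0, e 0, 0, hg 0, isHomogeneous_zero _ _ _, ?_⟩
    rw [← hspan, Set.range_unique, Set.pair_comm, Ideal.span_insert_zero]
    rfl
  · refine ⟨g 0, g 1, e 0, e 1, hg 0, hg 1, ?_⟩
    rw [← hspan]
    congr 1
    ext x
    simp [Fin.exists_fin_two, eq_comm]

/-- The Hilbert–Burch presentation of the ideal of an ACM curve with respect to irredundant
homogeneous generators. -/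
theorem SpaceCurve.IsACM.exists_hilbertBurch {C : SpaceCurve k} (hC : C.IsACM)
    (hC0 : C.ideal.toIdeal ≠ ⊥) {N : ℕ} {g : Fin N → CoordRing k} {e : Fin N → ℕ}
    (hg : ∀ i, (g i).IsHomogeneous (e i)) (hspan : Ideal.span (Set.range g) = C.ideal.toIdeal)
    (hirr : ∀ j, g j ∉ Ideal.span (g '' {j}ᶜ)) :
    ∃ (p : ℕ) (h : p + 1 = N) (s : Fin p → Fin (p + 1) → CoordRing k) (β : Fin p → ℕ) (u : k),
      (∀ j, IsShiftedHomogeneous (fun i => e (Fin.cast h i)) (β j) (s j)) ∧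
      (∀ j i, constantCoeff (s j i) = 0) ∧
      ∀ f : Fin (p + 1) → CoordRing k,
        ∑ i, f i * g (Fin.cast h i) = MvPolynomial.C u * detCons s f := by
  obtain ⟨hle, hht⟩ := two_le_height_map_idealOfVars C.dim_eq_one
  have hext := extOneVanishes_of_isCohenMacaulay hC hle hht
  obtain ⟨p, s, β, hsh, hs, hli, hsp⟩ := exists_homogeneous_basis_syzygies hext hspan hg
  have hg0 : ∃ i, g i ≠ 0 := by
    by_contra! hall
    apply hC0
    rw [← hspan, Ideal.span_eq_bot]
    rintro _ ⟨i, rfl⟩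
    exact hall i
  have hN := card_add_one_eq_of_basis_syzygies hg0 hs hli hsp
  subst hN
  have hcop : ∀ v, (∀ i, v ∣ g i) → IsUnit v := by
    intro v hv
    by_contra hvu
    have hv0 : v ≠ 0 := by
      rintro rfl
      obtain ⟨i, hi⟩ := hg0
      exact hi (zero_dvd_iff.mp (hv i))
    obtain ⟨c, hc, hcv⟩ := WfDvdMonoid.exists_irreducible_factor hvu hv0
    have hprime : (Ideal.span {c}).IsPrime :=
      (Ideal.span_singleton_prime hc.ne_zero).mpr hc.prime
    refine not_le_of_height_le_one C.ideal.isHomogeneous hC0 C.dim_eq_one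
      (Ideal.height_span_singleton_le_one hc.not_isUnit) ?_
    rw [← hspan, Ideal.span_le]
    rintro _ ⟨i, rfl⟩
    exact Ideal.mem_span_singleton.mpr (hcv.trans (hv i))
  obtain ⟨u, hu⟩ := exists_unit_sum_mul_eq_detCons hcop hg0 hs hli hsp
  have hconst : ∀ j i, constantCoeff (s j i) = 0 := by
    intro j i
    refine constantCoeff_eq_zero_of_notMem_span (β := e) (s := g) (hirr i) ?_
    simp only [smul_eq_mul]
    rw [← homogeneousComponent_sum_mul hg, hs, map_zero]
  obtain ⟨w, -, hw⟩ := MvPolynomial.isUnit_iff_eq_C_of_isReduced.mp u.isUnit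
  exact ⟨p, rfl, s, β, w, hsh, hconst, fun f => by rw [← hw]; exact hu f⟩

end Determinantal

theorem mainTheorem2 {k : Type*} [Field k] (d : ℕ) (F : CoordRing k)
    (hF : F.IsHomogeneous d) (hF0 : F ≠ 0)
    (hC : ∃ C : SpaceCurve k, C.LiesOn F ∧ C.IsACM ∧ ¬ C.IsCompleteIntersection) :
    ∃ (t : ℕ) (a b : Fin t → ℤ),
      IsWeakAdmissiblePair a b ∧ pairDegree a b = d ∧ IsWeakDeterminantal F a b := by
  classical
  obtain ⟨C, hFC, hACM, hCI⟩ := hC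
  have hC0 : C.ideal.toIdeal ≠ ⊥ := fun h => hF0 (by
    have h1 : F ∈ C.ideal.toIdeal := hFC
    rwa [h, Ideal.mem_bot] at h1)
  obtain ⟨N, g, e, hg, hspan, hirr, hcases⟩ :=
    exists_generators_adapted C.ideal.isHomogeneous hF hFC
  have hN : 3 ≤ N := by
    by_contra! h
    exact hCI (SpaceCurve.isCompleteIntersection_of_span_range_eq (by omega) hg hspan)
  obtain ⟨p, rfl, s, β, u, hsh, hconst, hdet⟩ := hACM.exists_hilbertBurch hC0 hg hspan hirr
  simp only [Fin.cast_eq_self] at hsh hdet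
  -- an entry without constant term in degree `≤ 0` vanishes
  have hzero : ∀ {v : Fin (p + 1) → CoordRing k} {b : ℕ}, IsShiftedHomogeneous e b v →
      (∀ i, constantCoeff (v i) = 0) → ∀ i, (b : ℤ) ≤ e i → v i = 0 := by
    intro v b hv hc i hb
    rcases (Nat.cast_le.mp hb).lt_or_eq with h | h
    · exact (hv i).2 h
    · have h1 := (hv i).1 h.ge
      rw [h, Nat.sub_self] at h1
      rw [← homogeneousComponent_eq_self h1, homogeneousComponent_zero, ← constantCoeff_eq, hc,
        C_0]
  have hhom : ∀ {v : Fin (p + 1) → CoordRing k} {b : ℕ}, IsShiftedHomogeneous e b v →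
      ∀ i, (e i : ℤ) < b → (v i).IsHomogeneous ((b : ℤ) - e i).toNat := by
    intro v b hv i hb
    have h1 : e i ≤ b := by exact_mod_cast hb.le
    rw [show ((b : ℤ) - e i).toNat = b - e i by omega]
    exact (hv i).1 h1
  rcases hcases with ⟨i₀, hi₀⟩ | ⟨f, hfh, hf, hfc⟩
  · -- `F` is a minimal generator, hence one of the maximal minors
    have h1 := hdet (Pi.single i₀ 1)
    simp only [Pi.single_apply, ite_mul, one_mul, zero_mul, Finset.sum_ite_eq', Finset.mem_univ,
      if_true] at h1
    rw [hi₀, detCons_apply, Matrix.det_succ_row_zero, Finset.sum_eq_single i₀] at h1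
    · refine exists_isWeakDeterminantal_of_det_eq (t := p) (a := fun i => (e (i₀.succAbove i) : ℤ))
        (b := fun j => (β j : ℤ)) (M := fun i j => s j (i₀.succAbove i)) hF hF0 (by omega)
        (fun i j h => hhom (hsh j) _ h) (fun i j h => hzero (hsh j) (hconst j) _ h)
        (u := u * (-1) ^ (i₀ : ℕ)) ?_
      rw [h1, ← Matrix.det_transpose]
      simp only [Matrix.of_apply, Fin.cons_zero, Pi.single_eq_same, mul_one, C_mul, C_pow, C_neg,
        C_1, mul_assoc]
      rfl
    · intro j _ hj
      simp [hj]
    · simp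
  · -- otherwise `F` is the determinant of the presentation matrix augmented by a column
    rw [hdet f, detCons_apply, ← Matrix.det_transpose] at hf
    refine exists_isWeakDeterminantal_of_det_eq (t := p + 1) (a := fun i => (e i : ℤ))
      (b := Fin.cons (d : ℤ) fun j => (β j : ℤ)) hF hF0 (by omega) (fun i j => ?_) (fun i j => ?_)
      hf.symm
    · refine Fin.cases ?_ (fun j => ?_) j
      · exact hhom hfh i
      · exact hhom (hsh j) i
    · refine Fin.cases ?_ (fun j => ?_) j
      · exact hzero hfh hfc i
      · exact hzero (hsh j) (hconst j) i
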